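/- Let $a<b$ be real numbers and let $\mathcal V\in L^1(\mathbb R,\mathbb R)$ have (essential) support $\operatorname{supp}\mathcal V=[a,b]$ and be positive in the sense that $\int_a^b\mathcal V|u|^2\,dx>0$ for every $u\in L^2(\mathbb R)$ that does not vanish a.e. on $(a,b)$ and for which $\mathcal V|u|^2$ is integrable on $(a,b)$. Write $\mathbb R_+=[0,\infty)$. For $\operatorname{Im}\zeta>0$ let $\chi_\pm(\cdot,\zeta)$ be the Jost solutions, i.e. the solutions of $-u''+\mathcal Vu=\zeta^2u$ on $\mathbb R$ ($u\in C^1$, $u'$ locally absolutely continuous) with $\chi_+(x,\zeta)=e^{i\zeta x}$ for $x>b$ and $\chi_-(x,\zeta)=e^{-i\zeta x}$ for $x<a$; let $w(\zeta)=\chi_+\chi_-'-\chi_+'\chi_-$ be their (constant) Wronskian. For $z\in\mathbb C\setminus\mathbb R_+$ let $\zeta$ be the square root of $z$ with $\operatorname{Im}\zeta>0$ and put $$\mathcal G^z(x,y)=\frac1{w(\zeta)}\begin{cases}\chi_+(x,\zeta)\chi_-(y,\zeta),&x\ge y,\\ \chi_-(x,\zeta)\chi_+(y,\zeta),&x<y,\end{cases}\qquad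 \mathcal H^z(x,y)=-\frac1{w(\zeta)}\begin{cases}\chi_+(x,\zeta)\chi_-'(y,\zeta),&x\ge y,\\ \chi_-(x,\zeta)\chi_+'(y,\zeta),&x<y,\end{cases}$$ $$\bigl(\gamma_1,\gamma_2,\gamma_3,\gamma_4\bigr)=\bigl(\mathcal G^z(\cdot,b),\,-\mathcal H^z(\cdot,b),\,\mathcal G^z(\cdot,a),\,-\mathcal H^z(\cdot,a)\bigr).$$ With $\Gamma_1u=\tfrac12\bigl(u(b^+)+u(b^-),\,u'(b^+)+u'(b^-),\,u(a^+)+u(a^-),\,u'(a^+)+u'(a^-)\bigr)^T$, let $q(z,\mathcal V)$ be the $4\times4$ matrix whose $j$-th column is $\Gamma_1\gamma_j$ (the Weyl function). For $\theta=(\theta_1,\theta_2)\in\mathbb C^2$ let $A_\theta=\operatorname{diag}\bigl(1+e^{\theta_2/2},\,1+e^{\theta_1/2},\,1+e^{-\theta_2/2},\,1+e^{-\theta_1/2}\bigr)$ and let $B_\theta$ be block diagonal with the blocks $b(\theta_1,\theta_2)$, $b(-\theta_1,-\theta_2)$, where $b(\theta_1,\theta_2)=2\begin{pmatrix}0&1-e^{\theta_2/2}\\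 e^{\theta_1/2}-1&0\end{pmatrix}$. Let $\mathcal B_\delta=\{\theta\in\mathbb C^2:|\theta_1|^2+|\theta_2|^2<\delta^2\}$. Then there is $\delta>0$ such that: 1. for all $\theta\in\mathcal B_\delta$ and all $z\in\mathbb C\setminus\mathbb R_+$ the matrix $B_\theta\,q(z,\mathcal V)-A_\theta$ is invertible; 2. the entries of $(B_\theta\,q(z,\mathcal V)-A_\theta)^{-1}$ are holomorphic functions of $(z,\theta_1,\theta_2)\in(\mathbb C\setminus\mathbb R_+)\times\mathcal B_\delta$; 3. these entries extend continuously to both sides of the cut: for each sign, the restriction to $\{z\notin\mathbb R_+,\ \pm\operatorname{Im}z\ge0\}\times\mathcal B_\delta$ has a continuous extension to $\{\pm\operatorname{Im}z\ge0\}\times\mathcal B_\delta$. Moreover, for $\theta\in\mathcal B_1$ and $z\in\mathbb C\setminus\mathbb R_+$, $$\det\bigl(B_\theta\,q(z,\mathcal V)-A_\theta\bigr)=4\Bigl(1+\cosh\frac{\theta_1}2\Bigr)\Bigl(1+\cosh\frac{\theta_2}2\Bigr)+\theta_1p_1(z,\theta)+\theta_2p_2(z,\theta)$$ with functions $p_1,p_2$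 that are bounded on $(\mathbb C\setminus\mathbb R_+)\times\mathcal B_1$. -/

import Mathlib

noncomputable section

namespace KreinModel

open MeasureTheory Complex

/-- Essential support: the complement of the largest open set on which `V` vanishes a.e. -/
def essSupport (V : ℝ → ℝ) : Set ℝ :=
  {x | ∀ U : Set ℝ, IsOpen U → x ∈ U → ¬ V =ᵐ[volume.restrict U] 0}

/-- `⟨u, V u⟩_{L²(a,b)} > 0` for every `u ∈ L²(ℝ)` that is not a.e. zero on `(a, b)` and for which
the quadratic form is finite. -/
def FormPositive (V : ℝ → ℝ) (a b : ℝ) : Prop :=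
  ∀ u : ℝ → ℂ, MemLp u 2 volume → ¬ u =ᵐ[volume.restrict (Set.Ioo a b)] 0 →
    IntegrableOn (fun x => V x * ‖u x‖ ^ 2) (Set.Ioo a b) →
    0 < ∫ x in Set.Ioo a b, V x * ‖u x‖ ^ 2

/-- `u` solves `-u'' + V u = ζ² u` on the line in the Carathéodory sense: `u` is differentiable and
`u'` is an indefinite integral of `(V - ζ²) u` (so `u` is `C¹` and `u'` is locally absolutely
continuous). -/
def IsSolution (V : ℝ → ℝ) (ζ : ℂ) (u : ℝ → ℂ) : Prop :=
  Differentiable ℝ u ∧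
    ∀ x y : ℝ, deriv u y - deriv u x = ∫ t in x..y, ((V t : ℂ) - ζ ^ 2) * u t

def IsJostPlus (V : ℝ → ℝ) (b : ℝ) (ζ : ℂ) (u : ℝ → ℂ) : Prop :=
  IsSolution V ζ u ∧ ∀ x : ℝ, b < x → u x = exp (I * ζ * x)

def IsJostMinus (V : ℝ → ℝ) (a : ℝ) (ζ : ℂ) (u : ℝ → ℂ) : Prop :=
  IsSolution V ζ u ∧ ∀ x : ℝ, x < a → u x = exp (-(I * ζ * x))

/-- The Jost solution `χ₊(·, ζ)`: the solution that equals `e^{iζx}` for `x > b`. -/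
def jostPlus (V : ℝ → ℝ) (b : ℝ) (ζ : ℂ) : ℝ → ℂ :=
  Classical.epsilon (IsJostPlus V b ζ)

/-- The Jost solution `χ₋(·, ζ)`: the solution that equals `e^{-iζx}` for `x < a`. -/
def jostMinus (V : ℝ → ℝ) (a : ℝ) (ζ : ℂ) : ℝ → ℂ :=
  Classical.epsilon (IsJostMinus V a ζ)

def wronskian (f g : ℝ → ℂ) (x : ℝ) : ℂ :=
  f x * deriv g x - deriv f x * g x

/-- The Jost function `w(ζ)`, the Wronskian of `χ₊` and `χ₋`. It does not depend on the point of
evaluation. -/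
def jostFun (V : ℝ → ℝ) (a b : ℝ) (ζ : ℂ) : ℂ :=
  wronskian (jostPlus V b ζ) (jostMinus V a ζ) a

/-- The closed half-line `ℝ₊ = [0, ∞)` in the complex plane. -/
def cut : Set ℂ := {z | z.im = 0 ∧ 0 ≤ z.re}

/-- For `z` off the cut, the square root of `z` in the open upper half-plane. -/
def upperSqrt (z : ℂ) : ℂ := I * (-z) ^ (1 / 2 : ℂ)

theorem upperSqrt_sq (z : ℂ) : upperSqrt z ^ 2 = z := by
  have h : ((-z) ^ (1 / 2 : ℂ)) ^ 2 = -z := by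
    rw [one_div]
    exact_mod_cast Complex.cpow_nat_inv_pow (-z) (n := 2) two_ne_zero
  rw [upperSqrt, mul_pow, I_sq, h]
  ring

theorem upperSqrt_im_pos {z : ℂ} (hz : z ∉ cut) : 0 < (upperSqrt z).im := by
  have hz0 : -z ≠ 0 := by
    intro h
    apply hz
    rw [neg_eq_zero.mp h]
    simp [cut]
  have harg : (-z).arg < Real.pi := by
    refine lt_of_le_of_ne (Complex.arg_le_pi _) fun h => hz ?_
    rw [Complex.arg_eq_pi_iff] at h
    obtain ⟨h1, h2⟩ := h
    simp only [neg_re, neg_im] at h1 h2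
    exact ⟨by linarith, by linarith⟩
  have harg' := Complex.neg_pi_lt_arg (-z)
  have hlog : Complex.log (-z) * (1 / 2) = ((Real.log ‖-z‖ / 2 : ℝ) : ℂ) +
      (((-z).arg / 2 : ℝ) : ℂ) * I := by
    rw [Complex.log]
    push_cast
    ring
  rw [upperSqrt, Complex.cpow_def_of_ne_zero hz0, hlog]
  simp only [mul_im, I_re, I_im, zero_mul, one_mul, zero_add, exp_re, add_re, ofReal_re,
    ofReal_im, mul_re, add_im, mul_zero, mul_one, sub_zero, add_zero]
  refine mul_pos (Real.exp_pos _) (Real.cos_pos_of_mem_Ioo ⟨?_, ?_⟩) <;> linarith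

/-- The kernel `G^ζ(x, y)`. -/
def kernelG (V : ℝ → ℝ) (a b : ℝ) (ζ : ℂ) (x y : ℝ) : ℂ :=
  (1 / jostFun V a b ζ) *
    (if y ≤ x then jostPlus V b ζ x * jostMinus V a ζ y
      else jostMinus V a ζ x * jostPlus V b ζ y)

/-- The kernel `H^ζ(x, y)`. -/
def kernelH (V : ℝ → ℝ) (a b : ℝ) (ζ : ℂ) (x y : ℝ) : ℂ :=
  -(1 / jostFun V a b ζ) *
    (if y ≤ x then jostPlus V b ζ x * deriv (jostMinus V a ζ) y
      else jostMinus V a ζ x * deriv (jostPlus V b ζ) y)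

/-- `𝒢^z(x, y) = G^ζ(x, y)` with `z = ζ²`, `Im ζ > 0`. -/
def greenG (V : ℝ → ℝ) (a b : ℝ) (z : ℂ) (x y : ℝ) : ℂ :=
  kernelG V a b (upperSqrt z) x y

/-- `ℋ^z(x, y) = H^ζ(x, y)` with `z = ζ²`, `Im ζ > 0`. -/
def greenH (V : ℝ → ℝ) (a b : ℝ) (z : ℂ) (x y : ℝ) : ℂ :=
  kernelH V a b (upperSqrt z) x y

/-- The functions `γ(e_i, z, V)`, a basis of the defect space. -/
def gammaField (V : ℝ → ℝ) (a b : ℝ) (z : ℂ) : Fin 4 → ℝ → ℂ :=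
  ![fun x => greenG V a b z x b, fun x => -greenH V a b z x b,
    fun x => greenG V a b z x a, fun x => -greenH V a b z x a]

/-- The boundary map `Γ₁`: mean values of the one-sided traces of `u` and `u'` at `b` and `a`. -/
def Gamma1 (a b : ℝ) (u : ℝ → ℂ) : Fin 4 → ℂ :=
  ![(1 / 2) * (Function.rightLim u b + Function.leftLim u b),
    (1 / 2) * (Function.rightLim (deriv u) b + Function.leftLim (deriv u) b),
    (1 / 2) * (Function.rightLim u a + Function.leftLim u a),
    (1 / 2) * (Function.rightLim (deriv u) a + Function.leftLim (deriv u) a)]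

/-- The matrix of the Weyl function `q(z, V) = Γ₁ ∘ γ(z, V)`: column `j` is `Γ₁ γ(e_j, z, V)`. -/
def weylMatrix (V : ℝ → ℝ) (a b : ℝ) (z : ℂ) : Matrix (Fin 4) (Fin 4) ℂ :=
  Matrix.of fun i j => Gamma1 a b (gammaField V a b z j) i

def matA (θ₁ θ₂ : ℂ) : Matrix (Fin 4) (Fin 4) ℂ :=
  !![1 + exp (θ₂ / 2), 0, 0, 0;
     0, 1 + exp (θ₁ / 2), 0, 0;
     0, 0, 1 + exp (-θ₂ / 2), 0;
     0, 0, 0, 1 + exp (-θ₁ / 2)]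

def matB (θ₁ θ₂ : ℂ) : Matrix (Fin 4) (Fin 4) ℂ :=
  !![0, 2 * (1 - exp (θ₂ / 2)), 0, 0;
     2 * (exp (θ₁ / 2) - 1), 0, 0, 0;
     0, 0, 0, 2 * (1 - exp (-θ₂ / 2));
     0, 0, 2 * (exp (-θ₁ / 2) - 1), 0]

/-- The matrix `B_θ q(z, V) - A_θ`. -/
def kreinMatrix (V : ℝ → ℝ) (a b : ℝ) (z θ₁ θ₂ : ℂ) : Matrix (Fin 4) (Fin 4) ℂ :=
  matB θ₁ θ₂ * weylMatrix V a b z - matA θ₁ θ₂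

/-- The open Euclidean ball of radius `δ` about the origin of `ℂ²`. -/
def thetaBall (δ : ℝ) : Set (ℂ × ℂ) := {θ | ‖θ.1‖ ^ 2 + ‖θ.2‖ ^ 2 < δ ^ 2}

end KreinModel

end

open KreinModel

noncomputable section

namespace KreinModel

open MeasureTheory Complex Filter Set Topology
open scoped BoundedContinuousFunction

/-! Everything is done in the variable `ζ = √z`, in the closed half-plane `Im ζ ≥ 0`, where both
sides of the cut become the real axis. For compactly supported `V` the Jost solutions at a fixed
point are entire in `ζ`, so the Weyl matrix is a ratio of entire functions with denominator the Jost
function `w(ζ)`.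

Positivity of `V` excludes zeros of `w` on the whole closed half-plane, including `ζ = 0`
(`IsJostMinus.deriv_sub_ne_zero`). Together with `|w(ζ)| ≥ |ζ|` for large `ζ`
(`IsJostMinus.high_energy`) and compactness, this gives `|w(ζ)| ≥ c(1 + |ζ|)`. Each derivative in
the boundary data costs one factor `s = 1 + |ζ|`, so the Weyl matrix satisfies `|q i j| ≤ C s ^ (o i
+ o j - 1)`, where `o` is the order of the trace, 0 or 1 (`exists_weylJost_bound`).

The matrix `B_θ` is of first order in `θ` and exchanges traces of order 0 and 1 at the same
endpoint. Hence conjugation by `diag(s ^ o i)` turns `B_θ q` into a matrix of size `O(|θ|)`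
uniformly in `ζ`, while the diagonal `A_θ` and the determinant do not change. So the determinant is
`det A_θ + O(|θ|)` (`exists_det_bound`), and it does not vanish for small `θ`. Cramer's rule then
makes the inverse holomorphic near every point of the closed half-plane in `ζ`; composition with
suitable branches of the root gives holomorphy off the cut and continuity up to each side. -/

/-! ### Integration by parts for absolutely continuous functions -/

/-- Increments of the primitive of `f` are dominated by those of the real primitive of `‖f‖`. -/
theorem absolutelyContinuousOnInterval_primitive {f : ℝ → ℂ} {a b : ℝ}
    (hf : IntervalIntegrable f volume a b) :
    AbsolutelyContinuousOnInterval (fun x => ∫ t in a..x, f t) a b := by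
  have h := hf.norm.absolutelyContinuousOnInterval_intervalIntegral (c := a) left_mem_uIcc
  rw [absolutelyContinuousOnInterval_iff] at h ⊢
  intro ε hε
  obtain ⟨δ, hδ, H⟩ := h ε hε
  refine ⟨δ, hδ, fun E hE hEδ => lt_of_le_of_lt (Finset.sum_le_sum fun i hi => ?_) (H E hE hEδ)⟩
  have hmem := hE.1 i hi
  have hint : ∀ x ∈ uIcc a b, IntervalIntegrable f volume a x := fun x hx =>
    hf.mono_set (uIcc_subset_uIcc left_mem_uIcc hx)
  rw [dist_comm, dist_comm (∫ t in a..(E.2 i).1, ‖f t‖), dist_eq_norm, dist_eq_norm,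
    intervalIntegral.integral_interval_sub_left (hint _ hmem.2) (hint _ hmem.1),
    intervalIntegral.integral_interval_sub_left (hint _ hmem.2).norm (hint _ hmem.1).norm]
  exact intervalIntegral.norm_integral_le_abs_integral_norm

/-- Integration by parts for the product of an indefinite integral with a `C¹` function. -/
theorem mul_sub_mul_eq_integral {F f G g : ℝ → ℂ}
    (hf : ∀ x y, IntervalIntegrable f volume x y)
    (hF : ∀ x y, F y - F x = ∫ t in x..y, f t)
    (hG : ∀ x, HasDerivAt G (g x) x) (hg : Continuous g) (x y : ℝ) :
    F y * G y - F x * G x = ∫ t in x..y, (f t * G t + F t * g t) := by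
  have hGc : Continuous G := continuous_iff_continuousAt.2 fun t => (hG t).continuousAt
  have hFeq : ∀ t, F t = F x + ∫ s in x..t, f s := fun t => by rw [← hF x t]; ring
  have hFc : Continuous F := by
    have := (intervalIntegral.continuous_primitive hf x).const_add (F x)
    exact this.congr fun t => (hFeq t).symm
  have hint : ∀ u v, IntervalIntegrable (fun t => f t * G t + F t * g t) volume u v := fun u v =>
    ((hf u v).mul_continuousOn hGc.continuousOn).add ((hFc.mul hg).intervalIntegrable u v)
  have hFac : AbsolutelyContinuousOnInterval F x y := by
    have h1 := absolutelyContinuousOnInterval_primitive (hf x y)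
    have h2 : AbsolutelyContinuousOnInterval (fun _ : ℝ => F x) x y :=
      (contDiffOn_const).absolutelyContinuousOnInterval
    have h3 := h2.add h1
    rwa [show (fun _ : ℝ => F x) + (fun t => ∫ s in x..t, f s) = F from
      (funext hFeq).symm] at h3
  have hGac : AbsolutelyContinuousOnInterval G x y := by
    refine ContDiffOn.absolutelyContinuousOnInterval (ContDiff.contDiffOn ?_)
    refine contDiff_one_iff_deriv.2 ⟨fun t => (hG t).differentiableAt, ?_⟩
    exact hg.congr fun t => ((hG t).deriv).symm
  -- `F` is differentiable only almost everywhere. The difference of the two sides is absolutely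
  -- continuous with derivative zero a.e., hence constant.
  have hΦ : AbsolutelyContinuousOnInterval
      (fun t => F t * G t - ∫ s in x..t, (f s * G s + F s * g s)) x y :=
    (hFac.smul hGac).sub (absolutelyContinuousOnInterval_primitive (hint x y))
  have hd : ∀ᵐ t, t ∈ uIcc x y →
      HasDerivAt (fun t => F t * G t - ∫ s in x..t, (f s * G s + F s * g s)) 0 t := by
    filter_upwards [(hf x y).ae_hasDerivAt_integral, (hint x y).ae_hasDerivAt_integral]
      with t h1 h2 ht
    have h1' : HasDerivAt F (f t) t := by
      have := (h1 ht x left_mem_uIcc).const_add (F x)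
      exact this.congr_of_eventuallyEq (Eventually.of_forall hFeq)
    exact ((h1'.mul (hG t)).sub (h2 ht x left_mem_uIcc)).congr_deriv (sub_self _)
  obtain ⟨C, hC⟩ := hΦ.const_of_ae_hasDerivAt_zero hd
  have hx := hC x left_mem_uIcc
  have hy := hC y right_mem_uIcc
  simp only [intervalIntegral.integral_same, sub_zero] at hx hy
  rw [hx, ← hy]
  ring

/-! ### Volterra operators in a space with weight `cosh (l (x - a))` -/

/-- The primitive of the weight is `sinh / l`, which is at most `cosh / l`: each integration gains a
factor `1 / l`. -/
theorem norm_integral_le_cosh {a l M x : ℝ} (hl : 0 < l) (hM : 0 ≤ M) {k : ℝ → ℂ}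
    (hk : ∀ s ∈ uIcc a x, ‖k s‖ ≤ M * Real.cosh (l * (s - a))) :
    ‖∫ s in a..x, k s‖ ≤ M / l * Real.cosh (l * (x - a)) := by
  have hd : ∀ s : ℝ, HasDerivAt (fun s => M / l * Real.sinh (l * (s - a)))
      (M * Real.cosh (l * (s - a))) s := fun s => by
    have h1 : HasDerivAt (fun s : ℝ => l * (s - a)) l s := by
      simpa using ((hasDerivAt_id s).sub_const a).const_mul l
    refine ((h1.sinh).const_mul (M / l)).congr_deriv ?_
    field_simp
  have hi : ∫ s in a..x, M * Real.cosh (l * (s - a)) = M / l * Real.sinh (l * (x - a)) := by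
    rw [intervalIntegral.integral_eq_sub_of_hasDerivAt (fun s _ => hd s)
      (Continuous.intervalIntegrable (by fun_prop) _ _)]
    simp
  have hle := intervalIntegral.norm_integral_le_abs_of_norm_le (μ := volume)
    (f := k) (g := fun s => M * Real.cosh (l * (s - a))) (a := a) (b := x)
    ((ae_restrict_iff' measurableSet_uIoc).2 (Eventually.of_forall fun s hs =>
      hk s (uIoc_subset_uIcc hs)))
    (Continuous.intervalIntegrable (by fun_prop) _ _)
  rw [hi, abs_mul, abs_of_nonneg (by positivity : 0 ≤ M / l)] at hle
  refine hle.trans (mul_le_mul_of_nonneg_left ?_ (by positivity))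
  rw [Real.abs_sinh, ← Real.cosh_abs]
  exact (Real.sinh_lt_cosh _).le

/-- The bound that makes the Volterra operator with coefficient `g` a contraction for the weight
`cosh (l (x - a))` with large `l`. -/
def WeightedBound (g : ℝ → ℂ) (a l N : ℝ) : Prop :=
  (∀ x y, IntervalIntegrable g volume x y) ∧
    ∀ (M : ℝ) (h : ℝ → ℂ) (x : ℝ), 0 ≤ M → Continuous h →
      (∀ t ∈ uIcc a x, ‖h t‖ ≤ M * Real.cosh (l * (t - a))) →
      ‖∫ t in a..x, g t * h t‖ ≤ N * M * Real.cosh (l * (x - a))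

theorem cosh_mono_of_mem_uIcc {a l s t : ℝ} (ht : t ∈ uIcc a s) :
    Real.cosh (l * (t - a)) ≤ Real.cosh (l * (s - a)) := by
  rw [Real.cosh_le_cosh, abs_mul, abs_mul]
  exact mul_le_mul_of_nonneg_left (abs_sub_left_of_mem_uIcc ht) (abs_nonneg l)

theorem norm_integral_mul_le {g h : ℝ → ℂ} (hg : Integrable g) {a x K : ℝ} (hK : 0 ≤ K)
    (hh : ∀ t ∈ uIcc a x, ‖h t‖ ≤ K) :
    ‖∫ t in a..x, g t * h t‖ ≤ (∫ t, ‖g t‖) * K := by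
  have hle := intervalIntegral.norm_integral_le_abs_of_norm_le (μ := volume)
    (f := fun t => g t * h t) (g := fun t => ‖g t‖ * K) (a := a) (b := x)
    ((ae_restrict_iff' measurableSet_uIoc).2 (Eventually.of_forall fun s hs => by
      rw [norm_mul]
      exact mul_le_mul_of_nonneg_left (hh s (uIoc_subset_uIcc hs)) (norm_nonneg _)))
    ((hg.norm.mul_const _).intervalIntegrable)
  refine hle.trans ?_
  rw [intervalIntegral.integral_mul_const, abs_mul, abs_of_nonneg hK]
  refine mul_le_mul_of_nonneg_right ?_ hK
  rw [intervalIntegral.abs_integral_eq_abs_integral_uIoc,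
    abs_of_nonneg (integral_nonneg fun _ => norm_nonneg _)]
  exact setIntegral_le_integral hg.norm (Eventually.of_forall fun _ => norm_nonneg _)

/-- The weight increases away from `a`, so its value at the endpoint can be pulled out. An `L¹`
coefficient yields no gain in `l`; that comes from the second integration. -/
theorem weightedBound_of_integrable {g : ℝ → ℂ} (hg : Integrable g) (a l : ℝ) :
    WeightedBound g a l (∫ t, ‖g t‖) := by
  refine ⟨fun x y => hg.intervalIntegrable, fun M h x hM _ hb => ?_⟩
  rw [mul_assoc]
  refine norm_integral_mul_le hg (mul_nonneg hM (Real.cosh_pos _).le) fun t ht =>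
    (hb t ht).trans ?_
  exact mul_le_mul_of_nonneg_left (cosh_mono_of_mem_uIcc ht) hM

theorem weightedBound_one {a l : ℝ} (hl : 0 < l) : WeightedBound (fun _ => 1) a l (1 / l) := by
  refine ⟨fun x y => intervalIntegrable_const, fun M h x hM _ hb => ?_⟩
  have := norm_integral_le_cosh hl hM hb
  simp only [one_mul]
  rwa [one_div, inv_mul_eq_div]

theorem WeightedBound.sub_const {g : ℝ → ℂ} {a l N : ℝ} (hg : WeightedBound g a l N)
    (hl : 0 < l) (z : ℂ) : WeightedBound (fun t => g t - z) a l (N + ‖z‖ / l) := by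
  refine ⟨fun x y => (hg.1 x y).sub intervalIntegrable_const, fun M h x hM hc hb => ?_⟩
  have h1 := hg.2 M h x hM hc hb
  have h2 := (weightedBound_one (a := a) hl).2 M h x hM hc hb
  have h3 : ∫ t in a..x, (g t - z) * h t
      = (∫ t in a..x, g t * h t) - z * ∫ t in a..x, 1 * h t := by
    rw [← intervalIntegral.integral_const_mul, ← intervalIntegral.integral_sub]
    · congr 1; ext t; ring
    · exact (hg.1 a x).mul_continuousOn hc.continuousOn
    · exact Continuous.intervalIntegrable (by fun_prop) _ _
  rw [h3]
  refine (norm_sub_le _ _).trans ?_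
  rw [norm_mul]
  have h4 := mul_le_mul_of_nonneg_left h2 (norm_nonneg z)
  calc _ ≤ _ := add_le_add h1 h4
    _ = _ := by ring

/-- The function `cosh (l (x - a)) v(x)`. -/
def weighted (a l : ℝ) (v : ℝ → ℂ) (x : ℝ) : ℂ := (Real.cosh (l * (x - a)) : ℂ) * v x

theorem continuous_weighted (a l : ℝ) {v : ℝ → ℂ} (hv : Continuous v) :
    Continuous (weighted a l v) :=
  (Complex.continuous_ofReal.comp (by fun_prop)).mul hv

theorem norm_weighted (a l : ℝ) (v : ℝ → ℂ) (x : ℝ) :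
    ‖weighted a l v x‖ = ‖v x‖ * Real.cosh (l * (x - a)) := by
  rw [weighted, norm_mul, Complex.norm_real, Real.norm_of_nonneg (Real.cosh_pos _).le, mul_comm]

theorem norm_weighted_le (a l : ℝ) (v : ℝ →ᵇ ℂ) (x : ℝ) :
    ‖weighted a l v x‖ ≤ ‖v‖ * Real.cosh (l * (x - a)) := by
  rw [norm_weighted]
  exact mul_le_mul_of_nonneg_right (v.norm_coe_le_norm x) (Real.cosh_pos _).le

theorem WeightedBound.continuous_primitive {g : ℝ → ℂ} {a l N : ℝ} (hg : WeightedBound g a l N)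
    {h : ℝ → ℂ} (hh : Continuous h) : Continuous (fun s => ∫ t in a..s, g t * h t) :=
  intervalIntegral.continuous_primitive
    (fun x y => (hg.1 x y).mul_continuousOn hh.continuousOn) a

theorem WeightedBound.norm_iterated_le {g : ℝ → ℂ} {a l N : ℝ} (hg : WeightedBound g a l N)
    (hl : 0 < l) (hN : 0 ≤ N) {M : ℝ} (hM : 0 ≤ M) {h : ℝ → ℂ} (hh : Continuous h) {x : ℝ}
    (hb : ∀ t ∈ uIcc a x, ‖h t‖ ≤ M * Real.cosh (l * (t - a))) :
    ‖∫ s in a..x, ∫ t in a..s, g t * h t‖ ≤ N / l * M * Real.cosh (l * (x - a)) := by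
  have := norm_integral_le_cosh (a := a) (x := x) (k := fun s => ∫ t in a..s, g t * h t) hl
    (mul_nonneg hN hM) fun s hs => hg.2 M h s hM hh fun t ht =>
      hb t (uIcc_subset_uIcc left_mem_uIcc hs ht)
  calc _ ≤ _ := this
    _ = _ := by ring

/-- Writing `u = cosh (l (x - a)) v` with `v` bounded and continuous makes the double integral a
bounded operator on a Banach space, of small norm for large `l`, so that Neumann series apply on the
whole line. -/
theorem WeightedBound.exists_operator {g : ℝ → ℂ} {a l N : ℝ} (hg : WeightedBound g a l N)
    (hl : 0 < l) (hN : 0 ≤ N) :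
    ∃ T : (ℝ →ᵇ ℂ) →L[ℂ] (ℝ →ᵇ ℂ), ‖T‖ ≤ N / l ∧
      ∀ v x, weighted a l (T v) x = ∫ s in a..x, ∫ t in a..s, g t * weighted a l v t := by
  have hcosh : ∀ x, (Real.cosh (l * (x - a)) : ℂ) ≠ 0 := fun x =>
    Complex.ofReal_ne_zero.2 (Real.cosh_pos _).ne'
  have hcont : ∀ v : ℝ →ᵇ ℂ, Continuous fun x => (Real.cosh (l * (x - a)) : ℂ)⁻¹ *
      ∫ s in a..x, ∫ t in a..s, g t * weighted a l v t := fun v => by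
    refine Continuous.mul (Continuous.inv₀
      (Complex.continuous_ofReal.comp (by fun_prop)) hcosh) ?_
    exact intervalIntegral.continuous_primitive (fun x y => (hg.continuous_primitive
      (continuous_weighted a l v.continuous)).intervalIntegrable x y) a
  have hbd : ∀ (v : ℝ →ᵇ ℂ) x, ‖(Real.cosh (l * (x - a)) : ℂ)⁻¹ *
      ∫ s in a..x, ∫ t in a..s, g t * weighted a l v t‖ ≤ N / l * ‖v‖ := fun v x => by
    rw [norm_mul, norm_inv, Complex.norm_real, Real.norm_of_nonneg (Real.cosh_pos _).le,
      inv_mul_le_iff₀ (Real.cosh_pos _), mul_comm]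
    exact hg.norm_iterated_le hl hN (norm_nonneg v) (continuous_weighted a l v.continuous)
      fun t _ => norm_weighted_le a l v t
  have hi : ∀ (v : ℝ →ᵇ ℂ) (x y : ℝ), IntervalIntegrable (fun t => g t * weighted a l v t)
      volume x y := fun v x y =>
    (hg.1 x y).mul_continuousOn (continuous_weighted a l v.continuous).continuousOn
  have hi' : ∀ (v : ℝ →ᵇ ℂ) (x y : ℝ), IntervalIntegrable
      (fun s => ∫ t in a..s, g t * weighted a l v t) volume x y := fun v x y =>
    (hg.continuous_primitive (continuous_weighted a l v.continuous)).intervalIntegrable x y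
  let T : (ℝ →ᵇ ℂ) →ₗ[ℂ] (ℝ →ᵇ ℂ) :=
    { toFun := fun v => BoundedContinuousFunction.ofNormedAddCommGroup _ (hcont v) _ (hbd v)
      map_add' := fun v w => by
        ext x
        simp only [BoundedContinuousFunction.coe_ofNormedAddCommGroup,
          BoundedContinuousFunction.coe_add, Pi.add_apply]
        rw [← mul_add, ← intervalIntegral.integral_add (hi' v a x) (hi' w a x)]
        congr 2
        ext s
        rw [← intervalIntegral.integral_add (hi v a s) (hi w a s)]
        congr 1
        ext t
        simp only [weighted, Pi.add_apply]
        ring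
      map_smul' := fun c v => by
        ext x
        simp only [BoundedContinuousFunction.coe_ofNormedAddCommGroup,
          BoundedContinuousFunction.coe_smul, RingHom.id_apply, smul_eq_mul]
        have h : ∀ s, ∫ t in a..s, g t * weighted a l (fun x => c * v x) t
            = c * ∫ t in a..s, g t * weighted a l v t := fun s => by
          rw [← intervalIntegral.integral_const_mul]
          refine intervalIntegral.integral_congr fun t _ => ?_
          simp only [weighted]
          ring
        simp_rw [h]
        rw [intervalIntegral.integral_const_mul]
        ring }
  refine ⟨T.mkContinuous (N / l) fun v => ?_, T.mkContinuous_norm_le (by positivity) _,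
    fun v x => ?_⟩
  · exact BoundedContinuousFunction.norm_ofNormedAddCommGroup_le (hcont v) (by positivity) (hbd v)
  · change (Real.cosh (l * (x - a)) : ℂ) * ((Real.cosh (l * (x - a)) : ℂ)⁻¹ *
      ∫ s in a..x, ∫ t in a..s, g t * weighted a l v t) = _
    exact mul_inv_cancel_left₀ (hcosh x) _

/-- Expresses `u'(x)` through continuous functionals of `v`, so that holomorphy of `v` in the
spectral parameter passes to `u'(x)`. -/
theorem WeightedBound.exists_functional {g : ℝ → ℂ} {a l N : ℝ} (hg : WeightedBound g a l N)
    (x : ℝ) : ∃ L : (ℝ →ᵇ ℂ) →L[ℂ] ℂ, ∀ v, L v = ∫ t in a..x, g t * weighted a l v t := by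
  have hi : ∀ (v : ℝ →ᵇ ℂ), IntervalIntegrable (fun t => g t * weighted a l v t)
      volume a x := fun v =>
    (hg.1 a x).mul_continuousOn (continuous_weighted a l v.continuous).continuousOn
  let L : (ℝ →ᵇ ℂ) →ₗ[ℂ] ℂ :=
    { toFun := fun v => ∫ t in a..x, g t * weighted a l v t
      map_add' := fun v w => by
        rw [← intervalIntegral.integral_add (hi v) (hi w)]
        congr 1
        ext t
        simp only [weighted, BoundedContinuousFunction.coe_add, Pi.add_apply]
        ring
      map_smul' := fun c v => by
        rw [RingHom.id_apply, smul_eq_mul, ← intervalIntegral.integral_const_mul]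
        congr 1
        ext t
        simp only [weighted, BoundedContinuousFunction.coe_smul, smul_eq_mul]
        ring }
  refine ⟨L.mkContinuous (N * Real.cosh (l * (x - a))) fun v => ?_, fun v => rfl⟩
  refine (hg.2 ‖v‖ _ x (norm_nonneg v) (continuous_weighted a l v.continuous) fun t _ =>
    norm_weighted_le a l v t).trans (le_of_eq (by ring))

/-! ### The Cauchy problem: uniqueness, existence, holomorphic dependence -/

theorem weightedBound_potential {V : ℝ → ℝ} (hV : Integrable V) (a : ℝ) {l : ℝ} (hl : 0 < l)
    (z : ℂ) : WeightedBound (fun t => (V t : ℂ) - z) a l ((∫ t, ‖V t‖) + ‖z‖ / l) := by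
  have := (weightedBound_of_integrable (g := fun t => (V t : ℂ)) hV.ofReal a l).sub_const hl z
  simpa only [Complex.norm_real] using this

theorem intervalIntegrable_potential_mul {V : ℝ → ℝ} (hV : Integrable V) (z : ℂ) {u : ℝ → ℂ}
    (hu : Continuous u) (x y : ℝ) :
    IntervalIntegrable (fun t => ((V t : ℂ) - z) * u t) volume x y :=
  ((hV.ofReal.intervalIntegrable).sub intervalIntegrable_const).mul_continuousOn hu.continuousOn

/-- A weight for which the Volterra operator with coefficient `V - z` contracts. -/
theorem exists_contracting_weight (K R : ℝ) (hK : 0 ≤ K) (hR : 0 ≤ R) :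
    ∃ l : ℝ, 0 < l ∧ ∀ r : ℝ, r ≤ R → (K + r / l) / l < 1 := by
  -- With `l = K + R + 1 ≥ 1` one has `r / l ≤ R`, hence `K + r / l ≤ K + R < l`.
  refine ⟨K + R + 1, by positivity, fun r hr => ?_⟩
  have hl : 0 < K + R + 1 := by positivity
  rw [div_lt_one hl]
  have : r / (K + R + 1) ≤ R := by
    rw [div_le_iff₀ hl]
    nlinarith
  linarith

/-- Local uniqueness for the Volterra form of `u'' = (V - z) u`. -/
theorem volterra_unique {V : ℝ → ℝ} (hV : Integrable V) (z : ℂ) {a x₀ : ℝ} {u : ℝ → ℂ}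
    (hu : Continuous u)
    (h : ∀ x ∈ uIcc a x₀, u x = ∫ s in a..x, ∫ t in a..s, ((V t : ℂ) - z) * u t) :
    ∀ x ∈ uIcc a x₀, u x = 0 := by
  obtain ⟨l, hl, hlt⟩ := exists_contracting_weight (∫ t, ‖V t‖) ‖z‖
    (integral_nonneg fun _ => norm_nonneg _) (norm_nonneg z)
  have hlt := hlt _ le_rfl
  have hW := weightedBound_potential hV a hl z
  obtain ⟨x₁, hx₁, hmax⟩ := isCompact_uIcc.exists_isMaxOn (s := uIcc a x₀) ⟨a, left_mem_uIcc⟩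
    (f := fun x => ‖u x‖ / Real.cosh (l * (x - a)))
    (Continuous.continuousOn (Continuous.div hu.norm (by fun_prop)
      fun x => (Real.cosh_pos _).ne'))
  -- `M` is the weighted sup norm of `u` on the interval. The Volterra equation gives `M ≤ q M` with
  -- `q < 1`, so `M = 0`.
  set M := ‖u x₁‖ / Real.cosh (l * (x₁ - a)) with hM
  have hM0 : 0 ≤ M := div_nonneg (norm_nonneg _) (Real.cosh_pos _).le
  have hb : ∀ t ∈ uIcc a x₀, ‖u t‖ ≤ M * Real.cosh (l * (t - a)) := fun t ht => by
    have := hmax ht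
    rwa [← div_le_iff₀ (Real.cosh_pos _)]
  have hN : 0 ≤ (∫ t, ‖V t‖) + ‖z‖ / l :=
    add_nonneg (integral_nonneg fun _ => norm_nonneg _) (by positivity)
  have h1 := hW.norm_iterated_le hl hN hM0 hu (x := x₁) fun t ht =>
    hb t (uIcc_subset_uIcc left_mem_uIcc hx₁ ht)
  rw [← h x₁ hx₁, ← div_le_iff₀ (Real.cosh_pos _), ← hM] at h1
  have hM1 : M = 0 := by nlinarith
  intro x hx
  have := hb x hx
  rw [hM1, zero_mul] at this
  exact norm_le_zero_iff.1 this

theorem IsSolution.continuous {V : ℝ → ℝ} {ζ : ℂ} {u : ℝ → ℂ} (hu : IsSolution V ζ u) :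
    Continuous u := hu.1.continuous

theorem IsSolution.continuous_deriv {V : ℝ → ℝ} (hV : Integrable V) {ζ : ℂ} {u : ℝ → ℂ}
    (hu : IsSolution V ζ u) : Continuous (deriv u) := by
  have h := (intervalIntegral.continuous_primitive
    (fun x y => intervalIntegrable_potential_mul hV (ζ ^ 2) hu.continuous x y) 0).const_add
    (deriv u 0)
  refine h.congr fun x => ?_
  rw [← hu.2 0 x]
  ring

theorem IsSolution.linear_comb {V : ℝ → ℝ} (hV : Integrable V) {ζ : ℂ} {u v : ℝ → ℂ}
    (hu : IsSolution V ζ u) (hv : IsSolution V ζ v) (c d : ℂ) :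
    IsSolution V ζ (fun x => c * u x + d * v x) ∧
      ∀ x, deriv (fun x => c * u x + d * v x) x = c * deriv u x + d * deriv v x := by
  have hd : ∀ x, deriv (fun x => c * u x + d * v x) x = c * deriv u x + d * deriv v x := fun x =>
    (((hu.1 x).hasDerivAt.const_mul c).add ((hv.1 x).hasDerivAt.const_mul d)).deriv
  refine ⟨⟨(hu.1.const_mul c).add (hv.1.const_mul d), fun x y => ?_⟩, hd⟩
  rw [hd, hd]
  have h1 := hu.2 x y
  have h2 := hv.2 x y
  have : ∫ t in x..y, ((V t : ℂ) - ζ ^ 2) * (c * u t + d * v t)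
      = c * (∫ t in x..y, ((V t : ℂ) - ζ ^ 2) * u t)
        + d * ∫ t in x..y, ((V t : ℂ) - ζ ^ 2) * v t := by
    rw [← intervalIntegral.integral_const_mul, ← intervalIntegral.integral_const_mul,
      ← intervalIntegral.integral_add]
    · congr 1; ext t; ring
    · exact (intervalIntegrable_potential_mul hV _ hu.continuous x y).const_mul c
    · exact (intervalIntegrable_potential_mul hV _ hv.continuous x y).const_mul d
  rw [this, ← h1, ← h2]
  ring

theorem IsSolution.unique {V : ℝ → ℝ} (hV : Integrable V) {ζ : ℂ} {u v : ℝ → ℂ}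
    (hu : IsSolution V ζ u) (hv : IsSolution V ζ v) {a : ℝ} (h0 : u a = v a)
    (h1 : deriv u a = deriv v a) : u = v := by
  obtain ⟨hw, hd⟩ := hu.linear_comb hV hv 1 (-1)
  set w := fun x => 1 * u x + -1 * v x with hwdef
  have hwa : w a = 0 := by simp [hwdef, h0]
  have hwa' : deriv w a = 0 := by rw [hd, h1]; ring
  have hder : ∀ s, deriv w s = ∫ t in a..s, ((V t : ℂ) - ζ ^ 2) * w t := fun s => by
    rw [← hw.2 a s, hwa', sub_zero]
  ext x
  have := volterra_unique hV (ζ ^ 2) (a := a) (x₀ := x) hw.continuous (fun y _ => by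
    simp_rw [← hder]
    rw [intervalIntegral.integral_deriv_eq_sub (fun t _ => hw.1 t)
      ((hw.continuous_deriv hV).intervalIntegrable _ _), hwa, sub_zero]) x right_mem_uIcc
  simp only [hwdef] at this
  linear_combination this

theorem norm_linear_le_cosh {l : ℝ} (hl : 0 < l) (c₀ c₁ : ℂ) (y : ℝ) :
    ‖c₀ + c₁ * (y : ℂ)‖ ≤ (‖c₀‖ + ‖c₁‖ / l) * Real.cosh (l * y) := by
  have h1 : 1 ≤ Real.cosh (l * y) := Real.one_le_cosh _
  have h2 : |l * y| ≤ Real.cosh (l * y) := by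
    rw [← Real.cosh_abs]
    exact (Real.self_le_sinh_iff.2 (abs_nonneg _)).trans (Real.sinh_lt_cosh _).le
  rw [abs_mul, abs_of_pos hl] at h2
  have h3 : |y| ≤ Real.cosh (l * y) / l := by rwa [le_div_iff₀ hl, mul_comm]
  calc ‖c₀ + c₁ * (y : ℂ)‖ ≤ ‖c₀‖ + ‖c₁‖ * |y| := by
        refine (norm_add_le _ _).trans ?_
        rw [norm_mul, Complex.norm_real, Real.norm_eq_abs]
    _ ≤ ‖c₀‖ * Real.cosh (l * y) + ‖c₁‖ * (Real.cosh (l * y) / l) :=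
        add_le_add (le_mul_of_one_le_right (norm_nonneg _) h1)
          (mul_le_mul_of_nonneg_left h3 (norm_nonneg _))
    _ = _ := by ring

theorem differentiableAt_inverse_one_sub_affine {A : Type*} [NormedRing A] [NormedAlgebra ℂ A]
    [CompleteSpace A] (T S : A) {z : ℂ} (h : IsUnit (1 - (T - z • S))) :
    DifferentiableAt ℂ (fun z : ℂ => Ring.inverse (1 - (T - z • S))) z := by
  have h1 : DifferentiableAt ℂ (fun z : ℂ => 1 - (T - z • S)) z := by fun_prop
  exact (differentiableAt_inverse (𝕜 := ℂ) h).comp z h1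

/-- The Cauchy problem at `a` is solvable, locally holomorphically in the spectral parameter. -/
theorem exists_solution_family {V : ℝ → ℝ} (hV : Integrable V) (a : ℝ) (c₀ c₁ : ℂ) {R : ℝ}
    (hR : 0 < R) : ∃ U : ℂ → ℝ → ℂ,
      (∀ ζ : ℂ, ζ ^ 2 ∈ Metric.ball (0 : ℂ) R → IsSolution V ζ (U (ζ ^ 2)) ∧
        U (ζ ^ 2) a = c₀ ∧ deriv (U (ζ ^ 2)) a = c₁) ∧
      ∀ x, DifferentiableOn ℂ (fun z => U z x) (Metric.ball 0 R) ∧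
        DifferentiableOn ℂ (fun z => deriv (U z) x) (Metric.ball 0 R) := by
  have hK : 0 ≤ ∫ t, ‖V t‖ := integral_nonneg fun _ => norm_nonneg _
  obtain ⟨l, hl, hlt⟩ := exists_contracting_weight (∫ t, ‖V t‖) R hK hR.le
  have hW1 : WeightedBound (fun t => (V t : ℂ)) a l (∫ t, ‖V t‖) := by
    simpa only [Complex.norm_real] using
      weightedBound_of_integrable (g := fun t => (V t : ℂ)) hV.ofReal a l
  have hW2 := weightedBound_one (a := a) hl
  obtain ⟨T, hTn, hT⟩ := hW1.exists_operator hl hK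
  obtain ⟨S, hSn, hS⟩ := hW2.exists_operator hl (by positivity)
  have hcosh : ∀ x, (Real.cosh (l * (x - a)) : ℂ) ≠ 0 := fun x =>
    Complex.ofReal_ne_zero.2 (Real.cosh_pos _).ne'
  let f : ℝ →ᵇ ℂ := BoundedContinuousFunction.ofNormedAddCommGroup
    (fun x : ℝ => (Real.cosh (l * (x - a)) : ℂ)⁻¹ * (c₀ + c₁ * ((x - a : ℝ) : ℂ)))
    (Continuous.mul (Continuous.inv₀ (Complex.continuous_ofReal.comp (by fun_prop)) hcosh)
      (by fun_prop)) (‖c₀‖ + ‖c₁‖ / l) (fun x => by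
        rw [norm_mul, norm_inv, Complex.norm_real, Real.norm_of_nonneg (Real.cosh_pos _).le,
          inv_mul_le_iff₀ (Real.cosh_pos _), mul_comm (Real.cosh _)]
        exact norm_linear_le_cosh hl c₀ c₁ (x - a))
  have hf : ∀ x, weighted a l f x = c₀ + c₁ * ((x - a : ℝ) : ℂ) := fun x => by
    change (Real.cosh (l * (x - a)) : ℂ) * ((Real.cosh (l * (x - a)) : ℂ)⁻¹ * _) = _
    exact mul_inv_cancel_left₀ (hcosh x) _
  -- The operator with coefficient `V - z` is `T - z S`, affine in `z` and of norm below 1 on the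
  -- whole ball. Its resolvent applied to the weighted free solution is therefore holomorphic in
  -- `z`.
  have hunit : ∀ z ∈ Metric.ball (0 : ℂ) R, IsUnit (1 - (T - z • S)) := fun z hz => by
    refine isUnit_one_sub_of_norm_lt_one (R := (ℝ →ᵇ ℂ) →L[ℂ] (ℝ →ᵇ ℂ)) (lt_of_le_of_lt ?_ (hlt ‖z‖ (by
      simpa using (mem_ball_zero_iff.1 hz).le)))
    refine (norm_sub_le _ _).trans ?_
    rw [norm_smul]
    calc ‖T‖ + ‖z‖ * ‖S‖ ≤ (∫ t, ‖V t‖) / l + ‖z‖ * (1 / l / l) :=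
          add_le_add hTn (mul_le_mul_of_nonneg_left hSn (norm_nonneg _))
      _ = _ := by field_simp
  let v : ℂ → (ℝ →ᵇ ℂ) := fun z => Ring.inverse (1 - (T - z • S)) f
  have hvd : DifferentiableOn ℂ v (Metric.ball 0 R) := fun z hz => by
    refine DifferentiableAt.differentiableWithinAt ?_
    have h2 := differentiableAt_inverse_one_sub_affine T S (hunit z hz)
    exact h2.clm_apply (differentiableAt_const f)
  have hveq : ∀ z ∈ Metric.ball (0 : ℂ) R, v z = f + T (v z) - z • S (v z) := fun z hz => by
    have := congrArg (fun A : (ℝ →ᵇ ℂ) →L[ℂ] (ℝ →ᵇ ℂ) => A f)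
      (Ring.mul_inverse_cancel _ (hunit z hz))
    simp only [mul_apply_eq_comp, one_apply_eq_self,
      sub_apply, smul_apply] at this
    rw [← this]
    simp only [v]
    abel
  let U : ℂ → ℝ → ℂ := fun z => weighted a l (v z)
  have hUc : ∀ z, Continuous (U z) := fun z => continuous_weighted a l (v z).continuous
  have hpc : ∀ z, Continuous fun s => ∫ t in a..s, ((V t : ℂ) - z) * U z t := fun z =>
    intervalIntegral.continuous_primitive (intervalIntegrable_potential_mul hV z (hUc z)) a
  have hsplit : ∀ z s, ∫ t in a..s, ((V t : ℂ) - z) * U z t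
      = (∫ t in a..s, (V t : ℂ) * U z t) - z * ∫ t in a..s, 1 * U z t := fun z s => by
    rw [← intervalIntegral.integral_const_mul, ← intervalIntegral.integral_sub]
    · congr 1; ext t; ring
    · exact (hW1.1 a s).mul_continuousOn (hUc z).continuousOn
    · exact (continuous_const.mul (continuous_const.mul (hUc z))).intervalIntegrable _ _
  have hUeq : ∀ z ∈ Metric.ball (0 : ℂ) R, ∀ x, U z x = c₀ + c₁ * ((x - a : ℝ) : ℂ)
      + ∫ s in a..x, ∫ t in a..s, ((V t : ℂ) - z) * U z t := fun z hz x => by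
    have h1 : U z x = weighted a l f x + weighted a l (T (v z)) x
        - z * weighted a l (S (v z)) x := by
      change weighted a l (v z) x = _
      rw [hveq z hz]
      simp only [weighted, BoundedContinuousFunction.coe_sub, BoundedContinuousFunction.coe_add,
        BoundedContinuousFunction.coe_smul, Pi.sub_apply, Pi.add_apply, smul_eq_mul]
      rw [← hveq z hz]
      ring
    rw [h1, hf, hT, hS]
    simp_rw [hsplit]
    rw [intervalIntegral.integral_sub, intervalIntegral.integral_const_mul]
    · ring
    · exact (hW1.continuous_primitive (hUc z)).intervalIntegrable _ _
    · exact (continuous_const.mul (hW2.continuous_primitive (hUc z))).intervalIntegrable _ _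
  have hUd : ∀ z ∈ Metric.ball (0 : ℂ) R, ∀ x, HasDerivAt (U z)
      (c₁ + ∫ t in a..x, ((V t : ℂ) - z) * U z t) x := fun z hz x => by
    have h1 : HasDerivAt (fun x => ∫ s in a..x, ∫ t in a..s, ((V t : ℂ) - z) * U z t)
        (∫ t in a..x, ((V t : ℂ) - z) * U z t) x :=
      intervalIntegral.integral_hasDerivAt_right ((hpc z).intervalIntegrable _ _)
        ((hpc z).stronglyMeasurableAtFilter _ _) (hpc z).continuousAt
    have h2 : HasDerivAt (fun x : ℝ => c₀ + c₁ * ((x - a : ℝ) : ℂ)) c₁ x := by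
      have := (((hasDerivAt_id x).sub_const a).ofReal_comp.const_mul c₁).const_add c₀
      simpa using this
    exact (h2.add h1).congr_of_eventuallyEq (Eventually.of_forall (hUeq z hz))
  refine ⟨U, fun ζ hζ => ⟨⟨fun x => (hUd _ hζ x).differentiableAt, fun x y => ?_⟩, ?_, ?_⟩,
    fun x => ⟨?_, ?_⟩⟩
  · rw [(hUd _ hζ x).deriv, (hUd _ hζ y).deriv, add_sub_add_left_eq_sub,
      intervalIntegral.integral_interval_sub_left
        (intervalIntegrable_potential_mul hV _ (hUc _) _ _)
        (intervalIntegrable_potential_mul hV _ (hUc _) _ _)]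
  · rw [hUeq _ hζ]; simp
  · rw [(hUd _ hζ a).deriv]; simp
  · have h1 := (BoundedContinuousFunction.evalCLM ℂ x).differentiable.comp_differentiableOn hvd
    exact h1.const_mul _
  · obtain ⟨L₁, hL₁⟩ := hW1.exists_functional x
    obtain ⟨L₂, hL₂⟩ := hW2.exists_functional x
    have h1 := L₁.differentiable.comp_differentiableOn hvd
    have h2 := L₂.differentiable.comp_differentiableOn hvd
    refine ((h1.sub (differentiableOn_id.mul h2)).const_add c₁).congr fun z hz => ?_
    rw [(hUd z hz x).deriv, hsplit]
    simp only [Function.comp, Pi.sub_apply, Pi.mul_apply, id, hL₁, hL₂]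
    rfl

/-- Solutions of the Cauchy problem at `a` with fixed data depend holomorphically on `ζ`. -/
theorem exists_entire_solution {V : ℝ → ℝ} (hV : Integrable V) (a : ℝ) (c₀ c₁ : ℂ) :
    ∃ U : ℂ → ℝ → ℂ,
      (∀ ζ : ℂ, IsSolution V ζ (U ζ) ∧ U ζ a = c₀ ∧ deriv (U ζ) a = c₁) ∧
      ∀ x, Differentiable ℂ (fun ζ => U ζ x) ∧ Differentiable ℂ (fun ζ => deriv (U ζ) x) := by
  have hpos : ∀ ζ : ℂ, 0 < ‖ζ ^ 2‖ + 1 := fun ζ => by positivity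
  have hmem : ∀ ζ : ℂ, ζ ^ 2 ∈ Metric.ball (0 : ℂ) (‖ζ ^ 2‖ + 1) := fun ζ =>
    mem_ball_zero_iff.2 (lt_add_one _)
  -- The weight depends on the ball, so each point has its own family; uniqueness of the Cauchy
  -- problem glues them.
  choose W hW hWd using fun ζ : ℂ => exists_solution_family hV a c₀ c₁ (hpos ζ)
  have hloc : ∀ ζ₀ : ℂ, ∀ᶠ ζ in 𝓝 ζ₀, ζ ^ 2 ∈ Metric.ball (0 : ℂ) (‖ζ₀ ^ 2‖ + 1) := fun ζ₀ =>
    (continuous_pow 2).continuousAt.preimage_mem_nhds (Metric.isOpen_ball.mem_nhds (hmem ζ₀))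
  have heq : ∀ ζ₀ : ℂ, ∀ᶠ ζ in 𝓝 ζ₀, W ζ (ζ ^ 2) = W ζ₀ (ζ ^ 2) := fun ζ₀ => by
    filter_upwards [hloc ζ₀] with ζ hζ
    obtain ⟨h1, h2, h3⟩ := hW ζ ζ (hmem ζ)
    obtain ⟨h1', h2', h3'⟩ := hW ζ₀ ζ hζ
    exact h1.unique hV h1' (h2.trans h2'.symm) (h3.trans h3'.symm)
  refine ⟨fun ζ => W ζ (ζ ^ 2), fun ζ => hW ζ ζ (hmem ζ), fun x => ⟨fun ζ₀ => ?_, fun ζ₀ => ?_⟩⟩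
  · have h1 := DifferentiableAt.comp (f := fun ζ : ℂ => ζ ^ 2) ζ₀
      ((hWd ζ₀ x).1.differentiableAt (Metric.isOpen_ball.mem_nhds (hmem ζ₀))) (by fun_prop)
    refine h1.congr_of_eventuallyEq ?_
    filter_upwards [heq ζ₀] with ζ hζ
    simp only [hζ, Function.comp]
  · have h1 := DifferentiableAt.comp (f := fun ζ : ℂ => ζ ^ 2) ζ₀
      ((hWd ζ₀ x).2.differentiableAt (Metric.isOpen_ball.mem_nhds (hmem ζ₀))) (by fun_prop)
    refine h1.congr_of_eventuallyEq ?_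
    filter_upwards [heq ζ₀] with ζ hζ
    simp only [hζ, Function.comp]

/-! ### Jost solutions: existence, Cauchy data, analyticity in `ζ` -/

theorem hasDerivAt_exp_mul (κ : ℂ) (x : ℝ) :
    HasDerivAt (fun x : ℝ => exp (κ * x)) (κ * exp (κ * x)) x := by
  have h := ((hasDerivAt_id x).ofReal_comp.const_mul κ).cexp
  exact h.congr_deriv (by simp [mul_comm])

theorem IsJostMinus.cauchy_data {V : ℝ → ℝ} (hV : Integrable V) {a : ℝ} {ζ : ℂ} {u : ℝ → ℂ}
    (hu : IsJostMinus V a ζ u) :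
    u a = exp (-(I * ζ * a)) ∧ deriv u a = -(I * ζ) * exp (-(I * ζ * a)) := by
  have ha : a ∈ closure (Iio a) := by rw [closure_Iio]; exact self_mem_Iic
  constructor
  · have h : EqOn u (fun x : ℝ => exp (-(I * ζ * x))) (Iio a) := fun x hx => hu.2 x hx
    exact h.closure hu.1.continuous (by fun_prop) ha
  · have h : EqOn (deriv u) (fun x : ℝ => -(I * ζ) * exp (-(I * ζ * x))) (Iio a) := fun x hx => by
      have he : u =ᶠ[𝓝 x] fun x : ℝ => exp (-(I * ζ) * x) := by
        filter_upwards [Iio_mem_nhds hx] with y hy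
        rw [hu.2 y hy, neg_mul]
      simp only
      rw [he.deriv_eq, (hasDerivAt_exp_mul _ x).deriv, neg_mul (I * ζ) (x : ℂ)]
    exact h.closure (hu.1.continuous_deriv hV) (by fun_prop) ha

/-- Take the solution with the Cauchy data of the plane wave at `a`. To the left of `a` the
potential vanishes a.e., so the difference from the plane wave solves the homogeneous Volterra
equation and is zero. -/
theorem exists_isJostMinus {V : ℝ → ℝ} (hV : Integrable V) {a : ℝ}
    (hV0 : V =ᵐ[volume.restrict (Iio a)] 0) (ζ : ℂ) : ∃ u, IsJostMinus V a ζ u := by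
  obtain ⟨U, hU, -⟩ := exists_entire_solution hV a (exp (-(I * ζ) * a))
    (-(I * ζ) * exp (-(I * ζ) * a))
  obtain ⟨hs, h0, h1⟩ := hU ζ
  set u := U ζ
  refine ⟨u, hs, fun x₀ hx₀ => ?_⟩
  set E : ℝ → ℂ := fun x => exp (-(I * ζ) * x) with hE
  have hEd : ∀ x, HasDerivAt E (-(I * ζ) * E x) x := fun x => hasDerivAt_exp_mul _ x
  have hEc : Continuous E := by fun_prop
  have hEd' : ∀ x y : ℝ, -(I * ζ) * E y - -(I * ζ) * E x = ∫ t in x..y, -ζ ^ 2 * E t := by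
    intro x y
    rw [intervalIntegral.integral_eq_sub_of_hasDerivAt
      (f := fun t => -(I * ζ) * E t) (fun t _ => ((hEd t).const_mul _).congr_deriv ?_)
      (Continuous.intervalIntegrable (by fun_prop) _ _)]
    linear_combination ζ ^ 2 * E t * I_sq
  have hVa : ∀ᵐ t, t < a → V t = 0 := (ae_restrict_iff' measurableSet_Iio).1 hV0
  have hna : ∀ᵐ t : ℝ, t ≠ a := by simp [ae_iff, measure_singleton]
  have hder : ∀ s ≤ a, deriv u s - -(I * ζ) * E s
      = ∫ t in a..s, ((V t : ℂ) - ζ ^ 2) * (u t - E t) := fun s hsa => by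
    have e1 : deriv u s - -(I * ζ) * E s
        = (∫ t in a..s, ((V t : ℂ) - ζ ^ 2) * u t) - ∫ t in a..s, -ζ ^ 2 * E t := by
      rw [← hs.2, ← hEd', h1]
      ring
    rw [e1, ← intervalIntegral.integral_sub]
    · refine intervalIntegral.integral_congr_ae ?_
      filter_upwards [hVa, hna] with t ht hta hts
      rw [uIoc_of_ge hsa] at hts
      rw [ht (lt_of_le_of_ne hts.2 hta)]
      push_cast
      ring
    · exact intervalIntegrable_potential_mul hV _ hs.continuous _ _
    · exact Continuous.intervalIntegrable (by fun_prop) _ _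
  have key := volterra_unique hV (ζ ^ 2) (a := a) (x₀ := x₀) (u := fun t => u t - E t)
    (hs.continuous.sub hEc) (fun x hx => ?_) x₀ right_mem_uIcc
  · rw [sub_eq_zero.1 key, hE]
    simp only [neg_mul]
  · rw [uIcc_of_ge hx₀.le] at hx
    have e2 : ∫ s in a..x, ∫ t in a..s, ((V t : ℂ) - ζ ^ 2) * (u t - E t)
        = ∫ s in a..x, (deriv u s - -(I * ζ) * E s) := by
      refine intervalIntegral.integral_congr fun s hs' => ?_
      rw [uIcc_of_ge hx.2] at hs'
      exact (hder s hs'.2).symm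
    rw [e2, intervalIntegral.integral_eq_sub_of_hasDerivAt
      (f := fun t => u t - E t) (fun t _ => (hs.1 t).hasDerivAt.sub (hEd t))
      (Continuous.intervalIntegrable ((hs.continuous_deriv hV).sub (by fun_prop)) _ _)]
    simp only [h0, hE, sub_self, sub_zero]

theorem isJostMinus_jostMinus {V : ℝ → ℝ} (hV : Integrable V) {a : ℝ}
    (hV0 : V =ᵐ[volume.restrict (Iio a)] 0) (ζ : ℂ) : IsJostMinus V a ζ (jostMinus V a ζ) :=
  Classical.epsilon_spec (exists_isJostMinus hV hV0 ζ)

/-- The Cauchy data of `χ₋` at `a` are entire in `ζ`, and `χ₋` is their combination with the two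
solutions of fixed Cauchy data `(1, 0)` and `(0, 1)`. -/
theorem differentiable_jostMinus {V : ℝ → ℝ} (hV : Integrable V) {a : ℝ}
    (hV0 : V =ᵐ[volume.restrict (Iio a)] 0) (x : ℝ) :
    Differentiable ℂ (fun ζ => jostMinus V a ζ x) ∧
      Differentiable ℂ (fun ζ => deriv (jostMinus V a ζ) x) := by
  obtain ⟨φ, hφ, hφd⟩ := exists_entire_solution hV a 1 0
  obtain ⟨ψ, hψ, hψd⟩ := exists_entire_solution hV a 0 1
  have heq : ∀ ζ, jostMinus V a ζ = fun x => exp (-(I * ζ * a)) * φ ζ x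
      + (-(I * ζ) * exp (-(I * ζ * a))) * ψ ζ x := fun ζ => by
    obtain ⟨h1, h2⟩ := (hφ ζ).1.linear_comb hV (hψ ζ).1 (exp (-(I * ζ * a)))
      (-(I * ζ) * exp (-(I * ζ * a)))
    have hj := isJostMinus_jostMinus hV hV0 ζ
    obtain ⟨h3, h4⟩ := hj.cauchy_data hV
    refine hj.1.unique hV h1 (a := a) ?_ ?_
    · rw [h3, (hφ ζ).2.1, (hψ ζ).2.1]; ring
    · rw [h4, h2, (hφ ζ).2.2, (hψ ζ).2.2]; ring
  have hd : ∀ ζ, deriv (jostMinus V a ζ) x = exp (-(I * ζ * a)) * deriv (φ ζ) x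
      + (-(I * ζ) * exp (-(I * ζ * a))) * deriv (ψ ζ) x := fun ζ => by
    rw [heq]
    exact ((hφ ζ).1.linear_comb hV (hψ ζ).1 _ _).2 x
  have p1 := (hφd x).1
  have p2 := (hφd x).2
  have p3 := (hψd x).1
  have p4 := (hψd x).2
  constructor
  · simp_rw [heq]
    fun_prop
  · simp_rw [hd]
    fun_prop

/-- The reflection `x ↦ -x` turns `χ₊` for `V` into `χ₋` for `V(-x)`, so all facts about `χ₊` follow
from those about `χ₋`. -/
theorem IsSolution.reflect {V : ℝ → ℝ} {ζ : ℂ} {u : ℝ → ℂ} (hu : IsSolution V ζ u) :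
    IsSolution (fun x => V (-x)) ζ (fun x => u (-x)) := by
  refine ⟨hu.1.comp differentiable_neg, fun x y => ?_⟩
  have h := intervalIntegral.integral_comp_neg (a := x) (b := y)
    (fun t => ((V t : ℂ) - ζ ^ 2) * u t)
  rw [h, ← hu.2, deriv_comp_neg, deriv_comp_neg]
  ring

theorem ae_restrict_Iio_reflect {V : ℝ → ℝ} {b : ℝ} (hV0 : V =ᵐ[volume.restrict (Ioi b)] 0) :
    (fun x => V (-x)) =ᵐ[volume.restrict (Iio (-b))] 0 := by
  have h1 : ∀ᵐ t, b < t → V t = 0 := (ae_restrict_iff' measurableSet_Ioi).1 hV0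
  refine (ae_restrict_iff' measurableSet_Iio).2 ?_
  have h2 := (Measure.measurePreserving_neg (volume : Measure ℝ)).quasiMeasurePreserving.ae h1
  filter_upwards [h2] with t ht hta
  exact ht (by simpa using neg_lt_neg (mem_Iio.1 hta))

theorem isJostPlus_jostPlus {V : ℝ → ℝ} (hV : Integrable V) {b : ℝ}
    (hV0 : V =ᵐ[volume.restrict (Ioi b)] 0) (ζ : ℂ) : IsJostPlus V b ζ (jostPlus V b ζ) := by
  refine Classical.epsilon_spec (p := IsJostPlus V b ζ) ?_
  obtain ⟨u, hu, hu'⟩ := exists_isJostMinus hV.comp_neg (ae_restrict_Iio_reflect hV0) ζ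
  refine ⟨fun x => u (-x), ?_, fun x hx => ?_⟩
  · have := hu.reflect
    simpa only [neg_neg] using this
  · change u (-x) = _
    rw [hu' (-x) (neg_lt_neg hx)]
    push_cast
    ring_nf

theorem IsJostPlus.reflect {V : ℝ → ℝ} {b : ℝ} {ζ : ℂ} {u : ℝ → ℂ} (hu : IsJostPlus V b ζ u) :
    IsJostMinus (fun x => V (-x)) (-b) ζ (fun x => u (-x)) := by
  refine ⟨hu.1.reflect, fun x hx => ?_⟩
  change u (-x) = _
  rw [hu.2 (-x) (by linarith)]
  push_cast
  ring_nf

theorem jostPlus_eq_reflect {V : ℝ → ℝ} (hV : Integrable V) {b : ℝ}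
    (hV0 : V =ᵐ[volume.restrict (Ioi b)] 0) (ζ : ℂ) :
    jostPlus V b ζ = fun x => jostMinus (fun x => V (-x)) (-b) ζ (-x) := by
  have h1 := (isJostPlus_jostPlus hV hV0 ζ).reflect
  have h2 := isJostMinus_jostMinus hV.comp_neg (ae_restrict_Iio_reflect hV0) ζ
  have h3 := h1.cauchy_data hV.comp_neg
  have h4 := h2.cauchy_data hV.comp_neg
  have h5 := h1.1.unique hV.comp_neg h2.1 (h3.1.trans h4.1.symm) (h3.2.trans h4.2.symm)
  ext x
  rw [← h5]
  simp only [neg_neg]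

theorem deriv_jostPlus_eq_reflect {V : ℝ → ℝ} (hV : Integrable V) {b : ℝ}
    (hV0 : V =ᵐ[volume.restrict (Ioi b)] 0) (ζ : ℂ) (x : ℝ) :
    deriv (jostPlus V b ζ) x = -deriv (jostMinus (fun x => V (-x)) (-b) ζ) (-x) := by
  rw [jostPlus_eq_reflect hV hV0, deriv_comp_neg]

theorem IsJostPlus.cauchy_data {V : ℝ → ℝ} (hV : Integrable V) {b : ℝ} {ζ : ℂ} {u : ℝ → ℂ}
    (hu : IsJostPlus V b ζ u) :
    u b = exp (I * ζ * b) ∧ deriv u b = I * ζ * exp (I * ζ * b) := by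
  obtain ⟨h1, h2⟩ := hu.reflect.cauchy_data hV.comp_neg
  rw [deriv_comp_neg] at h2
  simp only [neg_neg, ofReal_neg, mul_neg] at h1 h2
  exact ⟨h1, by linear_combination -h2⟩

theorem differentiable_jostPlus {V : ℝ → ℝ} (hV : Integrable V) {b : ℝ}
    (hV0 : V =ᵐ[volume.restrict (Ioi b)] 0) (x : ℝ) :
    Differentiable ℂ (fun ζ => jostPlus V b ζ x) ∧
      Differentiable ℂ (fun ζ => deriv (jostPlus V b ζ) x) := by
  obtain ⟨h1, h2⟩ := differentiable_jostMinus hV.comp_neg (ae_restrict_Iio_reflect hV0) (-x)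
  simp_rw [deriv_jostPlus_eq_reflect hV hV0, jostPlus_eq_reflect hV hV0]
  exact ⟨h1, h2.neg⟩

/-- A locally null subset of the line is null, since the topology is second countable. -/
theorem ae_eq_zero_of_disjoint_essSupport {V : ℝ → ℝ} {s : Set ℝ}
    (hs : MeasurableSet s) (hd : Disjoint s (essSupport V)) : V =ᵐ[volume.restrict s] 0 := by
  refine (ae_restrict_iff' hs).2 ?_
  have : volume {x | x ∈ s ∧ V x ≠ 0} = 0 := by
    refine measure_null_of_locally_null _ fun x hx => ?_
    have hx' : x ∉ essSupport V := fun h => disjoint_left.1 hd hx.1 h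
    simp only [essSupport, mem_ofPred_eq, not_forall, not_not] at hx'
    obtain ⟨U, hU, hxU, hUV⟩ := hx'
    refine ⟨U ∩ {x | x ∈ s ∧ V x ≠ 0}, ?_, ?_⟩
    · exact inter_mem (mem_nhdsWithin_of_mem_nhds (hU.mem_nhds hxU)) self_mem_nhdsWithin
    · have h := (ae_restrict_iff' hU.measurableSet).1 hUV
      refine measure_mono_null ?_ h
      intro y hy h'
      exact hy.2.2 (h' hy.1)
  rw [ae_iff]
  simpa only [Classical.not_imp, Pi.zero_apply] using this

/-! ### High-energy estimates -/

/-- `(u' - iκu) e^{iκx}` is constant for free solutions. The choices `κ = ζ` and `κ = -ζ` isolate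
the amplitudes of `e^{-iζx}` and `e^{iζx}`. -/
theorem IsSolution.exp_mul_sub_eq_integral {V : ℝ → ℝ} (hV : Integrable V) {ζ κ : ℂ}
    (hκ : κ ^ 2 = ζ ^ 2) {u : ℝ → ℂ} (hu : IsSolution V ζ u) (x y : ℝ) :
    (deriv u y - I * κ * u y) * exp (I * κ * y) - (deriv u x - I * κ * u x) * exp (I * κ * x)
      = ∫ t in x..y, (V t : ℂ) * (exp (I * κ * t) * u t) := by
  have hc := hu.continuous_deriv hV
  have hi := intervalIntegrable_potential_mul hV (ζ ^ 2) hu.continuous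
  have hi' : ∀ x y, IntervalIntegrable (fun t => I * κ * deriv u t) volume x y := fun x y =>
    (continuous_const.mul hc).intervalIntegrable x y
  have h := mul_sub_mul_eq_integral (F := fun t => deriv u t - I * κ * u t)
    (f := fun t => ((V t : ℂ) - ζ ^ 2) * u t - I * κ * deriv u t)
    (fun x y => (hi x y).sub (hi' x y))
    (fun x y => by
      rw [intervalIntegral.integral_sub (hi x y) (hi' x y), ← hu.2,
        intervalIntegral.integral_const_mul,
        intervalIntegral.integral_deriv_eq_sub (fun t _ => hu.1 t) (hc.intervalIntegrable _ _)]
      ring)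
    (fun t => hasDerivAt_exp_mul (I * κ) t) (by fun_prop) x y
  rw [h]
  refine intervalIntegral.integral_congr fun t _ => ?_
  linear_combination exp (I * κ * t) * u t * (hκ - κ ^ 2 * I_sq)

theorem norm_exp_I_mul_le_one {ζ : ℂ} (hζ : 0 ≤ ζ.im) {r : ℝ} (hr : 0 ≤ r) :
    ‖exp (I * ζ * r)‖ ≤ 1 := by
  rw [norm_exp]
  refine Real.exp_le_one_iff.2 ?_
  simp only [mul_re, I_re, I_im, mul_im, ofReal_re, ofReal_im]
  nlinarith [mul_nonneg hζ hr]

/-- High-energy bounds for the Jost solution at the right end of the support. -/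
theorem IsJostMinus.high_energy {V : ℝ → ℝ} (hV : Integrable V) {a b : ℝ} (hab : a ≤ b) {ζ : ℂ}
    (hζ : 0 ≤ ζ.im) (hζ0 : ζ ≠ 0) (hK : 2 * (∫ t, ‖V t‖) ≤ ‖ζ‖) {u : ℝ → ℂ}
    (hu : IsJostMinus V a ζ u) :
    ‖u b * exp (I * ζ * b)‖ ≤ 2 ∧ ‖deriv u b * exp (I * ζ * b)‖ ≤ 2 * ‖ζ‖ ∧
      ‖ζ‖ ≤ ‖(deriv u b - I * ζ * u b) * exp (I * ζ * b)‖ := by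
  have hζn : 0 < ‖ζ‖ := norm_pos_iff.2 hζ0
  obtain ⟨hua, hua'⟩ := hu.cauchy_data hV
  have huc := hu.1.continuous
  -- `M` is the maximum of `|e^{iζx} u|`, that is, of `u` with its growth removed.
  obtain ⟨x₁, hx₁, hmax⟩ := isCompact_Icc.exists_isMaxOn (s := Icc a b) ⟨a, left_mem_Icc.2 hab⟩
    (f := fun x : ℝ => ‖exp (I * ζ * x) * u x‖) (by fun_prop)
  set M := ‖exp (I * ζ * x₁) * u x₁‖
  have hM0 : 0 ≤ M := norm_nonneg _
  have hM : ∀ t ∈ Icc a b, ‖exp (I * ζ * t) * u t‖ ≤ M := fun t ht => hmax ht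
  have hVc : Integrable (fun t => (V t : ℂ)) := hV.ofReal
  have hexpa : exp (-(I * ζ * a)) * exp (I * ζ * a) = 1 := by
    rw [← exp_add, neg_add_cancel, exp_zero]
  have hβ : ∀ x ∈ Icc a b,
      ‖(deriv u x - I * ζ * u x) * exp (I * ζ * x) + 2 * I * ζ‖ ≤ (∫ t, ‖V t‖) * M := by
    intro x hx
    have h := hu.1.exp_mul_sub_eq_integral hV (κ := ζ) rfl a x
    rw [hua, hua'] at h
    have h' : (deriv u x - I * ζ * u x) * exp (I * ζ * x) + 2 * I * ζ
        = ∫ t in a..x, (V t : ℂ) * (exp (I * ζ * t) * u t) := by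
      rw [← h]
      linear_combination -2 * I * ζ * hexpa
    rw [h']
    have := norm_integral_mul_le (x := x) hVc hM0 (fun t ht => hM t (by
      rw [uIcc_of_le hx.1] at ht
      exact ⟨ht.1, ht.2.trans hx.2⟩))
    simpa only [Complex.norm_real] using this
  -- The amplitude of `e^{iζx}` vanishes at `a`. Rewritten with `e^{iζt} u(t)`, its integrand
  -- acquires `e^{2iζ(x-t)}`, of modulus at most 1 because `t ≤ x`.
  have hα : ∀ x ∈ Icc a b,
      ‖(deriv u x + I * ζ * u x) * exp (I * ζ * x)‖ ≤ (∫ t, ‖V t‖) * M := by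
    intro x hx
    have h := hu.1.exp_mul_sub_eq_integral hV (κ := -ζ) (by ring) a x
    rw [hua, hua'] at h
    have he : exp (I * ζ * x) = exp (2 * I * ζ * x) * exp (I * -ζ * x) := by
      rw [← exp_add]; ring_nf
    have h' : (deriv u x + I * ζ * u x) * exp (I * ζ * x)
        = ∫ t in a..x, (V t : ℂ) * (exp (2 * I * ζ * x) * (exp (I * -ζ * t) * u t)) := by
      have : ∀ t : ℝ, (V t : ℂ) * (exp (2 * I * ζ * x) * (exp (I * -ζ * t) * u t))
          = exp (2 * I * ζ * x) * ((V t : ℂ) * (exp (I * -ζ * t) * u t)) := fun t => by ring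
      simp_rw [this]
      rw [intervalIntegral.integral_const_mul, ← h, he]
      ring
    rw [h']
    have := norm_integral_mul_le (x := x)
      (h := fun t : ℝ => exp (2 * I * ζ * x) * (exp (I * -ζ * t) * u t)) hVc hM0 (fun t ht => by
        rw [uIcc_of_le hx.1] at ht
        have e : exp (2 * I * ζ * x) * (exp (I * -ζ * t) * u t)
            = exp (I * ζ * ((2 * (x - t) : ℝ) : ℂ)) * (exp (I * ζ * t) * u t) := by
          rw [← mul_assoc, ← mul_assoc, ← exp_add, ← exp_add]
          push_cast
          ring_nf
        rw [e, norm_mul]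
        have h1 := norm_exp_I_mul_le_one hζ (r := 2 * (x - t)) (by linarith [ht.2])
        have h2 := hM t ⟨ht.1, ht.2.trans hx.2⟩
        calc _ ≤ 1 * M := mul_le_mul h1 h2 (norm_nonneg _) zero_le_one
          _ = M := one_mul M)
    simpa only [Complex.norm_real] using this
  have h2ζ : ‖2 * I * ζ‖ = 2 * ‖ζ‖ := by simp
  -- Subtracting the two amplitudes gives `2|ζ| M ≤ 2 K M + 2|ζ|` with `K = ∫ |V|`, and `2 K ≤ |ζ|`
  -- absorbs the first term.
  have hM2 : M ≤ 2 := by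
    have h1 := hα x₁ hx₁
    have h2 := hβ x₁ hx₁
    have e : 2 * I * ζ * (exp (I * ζ * x₁) * u x₁)
        = (deriv u x₁ + I * ζ * u x₁) * exp (I * ζ * x₁)
          - ((deriv u x₁ - I * ζ * u x₁) * exp (I * ζ * x₁) + 2 * I * ζ) + 2 * I * ζ := by ring
    have h3 : ‖2 * I * ζ * (exp (I * ζ * x₁) * u x₁)‖
        ≤ (∫ t, ‖V t‖) * M + (∫ t, ‖V t‖) * M + 2 * ‖ζ‖ := by
      rw [e]
      refine (norm_add_le _ _).trans (add_le_add ((norm_sub_le _ _).trans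
        (add_le_add h1 h2)) h2ζ.le)
    rw [norm_mul, h2ζ] at h3
    have h4 : 2 * (∫ t, ‖V t‖) * M ≤ ‖ζ‖ * M := mul_le_mul_of_nonneg_right hK hM0
    have h5 : ‖ζ‖ * M ≤ ‖ζ‖ * 2 := by
      change 2 * ‖ζ‖ * M ≤ _ at h3
      linarith
    exact le_of_mul_le_mul_left h5 hζn
  have hKM : (∫ t, ‖V t‖) * M ≤ ‖ζ‖ := by
    have : 0 ≤ ∫ t, ‖V t‖ := integral_nonneg fun _ => norm_nonneg _
    nlinarith
  have hb : b ∈ Icc a b := right_mem_Icc.2 hab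
  have hαb := (hα b hb).trans hKM
  have hβb := (hβ b hb).trans hKM
  refine ⟨?_, ?_, ?_⟩
  · rw [mul_comm]
    exact (hM b hb).trans hM2
  · have e : 2 * (deriv u b * exp (I * ζ * b))
        = (deriv u b + I * ζ * u b) * exp (I * ζ * b)
          + ((deriv u b - I * ζ * u b) * exp (I * ζ * b) + 2 * I * ζ) - 2 * I * ζ := by ring
    have h3 : ‖2 * (deriv u b * exp (I * ζ * b))‖ ≤ ‖ζ‖ + ‖ζ‖ + 2 * ‖ζ‖ := by
      rw [e]
      exact (norm_sub_le _ _).trans (add_le_add ((norm_add_le _ _).trans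
        (add_le_add hαb hβb)) h2ζ.le)
    rw [norm_mul, Complex.norm_ofNat] at h3
    linarith
  · have h4 := norm_sub_le ((deriv u b - I * ζ * u b) * exp (I * ζ * b) + 2 * I * ζ)
      ((deriv u b - I * ζ * u b) * exp (I * ζ * b))
    rw [add_sub_cancel_left, h2ζ] at h4
    linarith

/-! ### Absence of zeros of the Jost function and uniform bounds -/

/-- A solution need not be in `L²(ℝ)`, so positivity is applied to its cut-off to `(a, b)`. By
continuity `u a ≠ 0` prevents it from vanishing a.e. there. -/
theorem integral_potential_mul_normSq_pos {V : ℝ → ℝ} (hV : Integrable V) {a b : ℝ}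
    (hab : a < b) (hpos : FormPositive V a b) {u : ℝ → ℂ} (hu : Continuous u) (hua : u a ≠ 0) :
    0 < ∫ x in a..b, V x * ‖u x‖ ^ 2 := by
  have hcongr : ∀ x ∈ Ioo a b, V x * ‖(Ioo a b).indicator u x‖ ^ 2 = V x * ‖u x‖ ^ 2 :=
    fun x hx => by rw [indicator_of_mem hx]
  have h := hpos ((Ioo a b).indicator u) ?_ ?_ ?_
  · rw [setIntegral_congr_fun measurableSet_Ioo hcongr] at h
    rwa [intervalIntegral.integral_of_le hab.le, integral_Ioc_eq_integral_Ioo]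
  · rw [memLp_indicator_iff_restrict measurableSet_Ioo]
    obtain ⟨C, hC⟩ := isCompact_Icc.exists_bound_of_continuousOn (s := Icc a b) hu.continuousOn
    refine MemLp.of_bound hu.aestronglyMeasurable C ?_
    exact (ae_restrict_iff' measurableSet_Ioo).2 (Eventually.of_forall fun x hx =>
      hC x (Ioo_subset_Icc_self hx))
  · intro h0
    have h1 : u =ᵐ[volume.restrict (Ioo a b)] 0 := by
      refine EventuallyEq.trans ?_ h0
      exact (ae_restrict_iff' measurableSet_Ioo).2 (Eventually.of_forall fun x hx =>
        (indicator_of_mem hx u).symm)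
    have h2 := Measure.eqOn_open_of_ae_eq h1 isOpen_Ioo hu.continuousOn continuousOn_const
    have h3 := h2.closure hu continuous_const
    rw [closure_Ioo hab.ne] at h3
    exact hua (h3 (left_mem_Icc.2 hab.le))
  · have h1 : IntervalIntegrable (fun x => V x * ‖u x‖ ^ 2) volume a b :=
      hV.intervalIntegrable.mul_continuousOn (by fun_prop)
    rw [intervalIntegrable_iff_integrableOn_Ioo_of_le hab.le] at h1
    exact h1.congr_fun (fun x hx => (hcongr x hx).symm) measurableSet_Ioo

/-- The Jost function has no zeros in the closed upper half-plane. -/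
theorem IsJostMinus.deriv_sub_ne_zero {V : ℝ → ℝ} (hV : Integrable V) {a b : ℝ} (hab : a < b)
    (hpos : FormPositive V a b) {ζ : ℂ} (hζ : 0 ≤ ζ.im) {u : ℝ → ℂ} (hu : IsJostMinus V a ζ u) :
    deriv u b - I * ζ * u b ≠ 0 := by
  intro h0
  obtain ⟨hua, hua'⟩ := hu.cauchy_data hV
  have huc := hu.1.continuous
  have hdc := hu.1.continuous_deriv hV
  have hua0 : u a ≠ 0 := by rw [hua]; exact exp_ne_zero _
  have hub' : deriv u b = I * ζ * u b := sub_eq_zero.1 h0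
  have hua'' : deriv u a = -(I * ζ) * u a := by rw [hua', hua]
  have hGd : ∀ x, HasDerivAt (fun x => star (u x)) (star (deriv u x)) x := fun x =>
    (hu.1.1 x).hasDerivAt.star
  -- Pairing the equation with the conjugate of `u` gives `iζ(N₁ + N₂) = P - ζ²Q + S`; the boundary
  -- terms come from the radiation condition at both ends.
  have h := mul_sub_mul_eq_integral (F := deriv u)
    (intervalIntegrable_potential_mul hV (ζ ^ 2) huc) hu.1.2 hGd (by fun_prop) a b
  have hsq : ∀ w : ℂ, w * star w = ((‖w‖ ^ 2 : ℝ) : ℂ) := fun w => by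
    push_cast
    exact Complex.mul_conj' w
  have hi1 : IntervalIntegrable (fun x => V x * ‖u x‖ ^ 2) volume a b :=
    hV.intervalIntegrable.mul_continuousOn (by fun_prop)
  have hi2 : IntervalIntegrable (fun x => ‖u x‖ ^ 2) volume a b :=
    Continuous.intervalIntegrable (by fun_prop) _ _
  have hi3 : IntervalIntegrable (fun x => ‖deriv u x‖ ^ 2) volume a b :=
    Continuous.intervalIntegrable (by fun_prop) _ _
  have hof : ∀ {f : ℝ → ℝ}, IntervalIntegrable f volume a b →
      IntervalIntegrable (fun t => (f t : ℂ)) volume a b := fun hf => ⟨hf.1.ofReal, hf.2.ofReal⟩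
  have hint : ∫ t in a..b, (((V t : ℂ) - ζ ^ 2) * u t * star (u t) + deriv u t * star (deriv u t))
      = ((∫ t in a..b, V t * ‖u t‖ ^ 2 : ℝ) : ℂ) - ζ ^ 2 * ((∫ t in a..b, ‖u t‖ ^ 2 : ℝ) : ℂ)
        + ((∫ t in a..b, ‖deriv u t‖ ^ 2 : ℝ) : ℂ) := by
    rw [← intervalIntegral.integral_ofReal, ← intervalIntegral.integral_ofReal,
      ← intervalIntegral.integral_ofReal, ← intervalIntegral.integral_const_mul,
      ← intervalIntegral.integral_sub (hof hi1) ((hof hi2).const_mul _),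
      ← intervalIntegral.integral_add ((hof hi1).sub ((hof hi2).const_mul _)) (hof hi3)]
    refine intervalIntegral.integral_congr fun t _ => ?_
    simp only [mul_assoc, hsq]
    push_cast
    ring
  rw [hint, hub', hua'', mul_assoc (I * ζ), mul_assoc (-(I * ζ)), hsq, hsq] at h
  have hP := integral_potential_mul_normSq_pos hV hab hpos huc hua0
  have hQ : 0 ≤ ∫ t in a..b, ‖u t‖ ^ 2 :=
    intervalIntegral.integral_nonneg hab.le fun _ _ => by positivity
  have hS : 0 ≤ ∫ t in a..b, ‖deriv u t‖ ^ 2 :=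
    intervalIntegral.integral_nonneg hab.le fun _ _ => by positivity
  have hN1 : 0 ≤ ‖u b‖ ^ 2 := by positivity
  have hN2 : 0 < ‖u a‖ ^ 2 := by positivity
  generalize (∫ t in a..b, V t * ‖u t‖ ^ 2) = P at *
  generalize (∫ t in a..b, ‖u t‖ ^ 2) = Q at *
  generalize (∫ t in a..b, ‖deriv u t‖ ^ 2) = S at *
  generalize ‖u b‖ ^ 2 = N₁ at *
  generalize ‖u a‖ ^ 2 = N₂ at *
  have hre := congrArg Complex.re h
  have him := congrArg Complex.im h
  simp [sq] at hre him
  -- The imaginary part forces `Re ζ = 0`, since `N₂ > 0`. With `ζ = iη`, `η ≥ 0`, the real part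
  -- reads `-η(N₁ + N₂) = P + η²Q + S > 0`, a contradiction that also covers `ζ = 0`.
  have hξ : ζ.re * (N₁ + N₂ + 2 * ζ.im * Q) = 0 := by linarith
  have hpos' : 0 < N₁ + N₂ + 2 * ζ.im * Q := by positivity
  have hξ0 : ζ.re = 0 := (mul_eq_zero.1 hξ).resolve_right hpos'.ne'
  rw [hξ0] at hre
  nlinarith [mul_nonneg hζ hN1, mul_nonneg hζ hN2.le, mul_nonneg (mul_nonneg hζ hζ) hQ]

theorem exists_jostMinus_bounds {V : ℝ → ℝ} (hV : Integrable V) {a b : ℝ} (hab : a ≤ b)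
    (hV0 : V =ᵐ[volume.restrict (Iio a)] 0) :
    ∃ C : ℝ, ∀ ζ : ℂ, 0 ≤ ζ.im →
      ‖jostMinus V a ζ b * exp (I * ζ * b)‖ ≤ C ∧
      ‖deriv (jostMinus V a ζ) b * exp (I * ζ * b)‖ ≤ C * (1 + ‖ζ‖) := by
  obtain ⟨hd, hd'⟩ := differentiable_jostMinus hV hV0 b
  -- Beyond `R` the high-energy estimate applies with `ζ ≠ 0`; inside, continuity on a compact disc
  -- suffices.
  set R : ℝ := 2 * (∫ t, ‖V t‖) + 1
  have hK : 0 ≤ ∫ t, ‖V t‖ := integral_nonneg fun _ => norm_nonneg _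
  have hdc := hd.continuous
  have hdc' := hd'.continuous
  obtain ⟨C₁, hC₁⟩ := (isCompact_closedBall (0 : ℂ) R).exists_bound_of_continuousOn
    (f := fun ζ : ℂ => jostMinus V a ζ b * exp (I * ζ * b)) (by fun_prop)
  obtain ⟨C₂, hC₂⟩ := (isCompact_closedBall (0 : ℂ) R).exists_bound_of_continuousOn
    (f := fun ζ : ℂ => deriv (jostMinus V a ζ) b * exp (I * ζ * b)) (by fun_prop)
  have h0 : (0 : ℂ) ∈ Metric.closedBall (0 : ℂ) R := Metric.mem_closedBall_self (by positivity)
  have hC₁0 := (norm_nonneg _).trans (hC₁ 0 h0)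
  have hC₂0 := (norm_nonneg _).trans (hC₂ 0 h0)
  refine ⟨C₁ + C₂ + 2, fun ζ hζ => ?_⟩
  have hs : 1 ≤ 1 + ‖ζ‖ := by linarith [norm_nonneg ζ]
  rcases le_total ‖ζ‖ R with h | h
  · have hm : ζ ∈ Metric.closedBall (0 : ℂ) R := mem_closedBall_zero_iff.2 h
    refine ⟨(hC₁ ζ hm).trans (by linarith), (hC₂ ζ hm).trans ?_⟩
    nlinarith
  · have hζ0 : ζ ≠ 0 := norm_pos_iff.1 (lt_of_lt_of_le (by positivity) h)
    obtain ⟨h1, h2, -⟩ := (isJostMinus_jostMinus hV hV0 ζ).high_energy hV hab hζ hζ0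
      (by simp only [R] at h; linarith)
    refine ⟨h1.trans (by linarith), h2.trans ?_⟩
    nlinarith

/-- On a compact half-disc the nonvanishing continuous modulus has a positive minimum; outside it
the high-energy bound `|ζ| ≥ (1 + |ζ|)/2` takes over. -/
theorem exists_jost_lower_bound {V : ℝ → ℝ} (hV : Integrable V) {a b : ℝ} (hab : a < b)
    (hV0 : V =ᵐ[volume.restrict (Iio a)] 0) (hpos : FormPositive V a b) :
    ∃ c : ℝ, 0 < c ∧ ∀ ζ : ℂ, 0 ≤ ζ.im → c * (1 + ‖ζ‖) ≤
      ‖(deriv (jostMinus V a ζ) b - I * ζ * jostMinus V a ζ b) * exp (I * ζ * b)‖ := by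
  obtain ⟨hd, hd'⟩ := differentiable_jostMinus hV hV0 b
  set R : ℝ := 2 * (∫ t, ‖V t‖) + 1 with hR
  have hK : 0 ≤ ∫ t, ‖V t‖ := integral_nonneg fun _ => norm_nonneg _
  have hdc := hd.continuous
  have hdc' := hd'.continuous
  have hcomp : IsCompact (Metric.closedBall (0 : ℂ) R ∩ {ζ : ℂ | 0 ≤ ζ.im}) :=
    (isCompact_closedBall _ _).inter_right (isClosed_le continuous_const Complex.continuous_im)
  obtain ⟨ζ₁, hζ₁, hmin⟩ := hcomp.exists_isMinOn
    (f := fun ζ : ℂ =>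
      ‖(deriv (jostMinus V a ζ) b - I * ζ * jostMinus V a ζ b) * exp (I * ζ * b)‖)
    ⟨0, Metric.mem_closedBall_self (by positivity), by simp⟩ (by fun_prop)
  set μ := ‖(deriv (jostMinus V a ζ₁) b - I * ζ₁ * jostMinus V a ζ₁ b) * exp (I * ζ₁ * b)‖ with hμ
  have hμ0 : 0 < μ := norm_pos_iff.2 (mul_ne_zero
    ((isJostMinus_jostMinus hV hV0 ζ₁).deriv_sub_ne_zero hV hab hpos hζ₁.2) (exp_ne_zero _))
  refine ⟨min (μ / (1 + R)) (1 / 2), by positivity, fun ζ hζ => ?_⟩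
  rcases le_total ‖ζ‖ R with h | h
  · refine le_trans ?_ (hmin ⟨mem_closedBall_zero_iff.2 h, hζ⟩)
    change _ ≤ μ
    calc _ ≤ μ / (1 + R) * (1 + R) := by
          refine mul_le_mul (min_le_left _ _) (by linarith) (by positivity) (by positivity)
      _ = μ := div_mul_cancel₀ _ (by positivity)
  · have hζ0 : ζ ≠ 0 := norm_pos_iff.1 (lt_of_lt_of_le (by positivity) h)
    obtain ⟨-, -, h3⟩ := (isJostMinus_jostMinus hV hV0 ζ).high_energy hV hab.le hζ hζ0
      (by linarith)
    refine le_trans ?_ h3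
    have : min (μ / (1 + R)) (1 / 2) * (1 + ‖ζ‖) ≤ 1 / 2 * (1 + ‖ζ‖) :=
      mul_le_mul_of_nonneg_right (min_le_right _ _) (by positivity)
    linarith

/-! ### One-sided traces and the explicit Weyl matrix -/

theorem wronskian_const {V : ℝ → ℝ} (hV : Integrable V) {ζ : ℂ} {u v : ℝ → ℂ}
    (hu : IsSolution V ζ u) (hv : IsSolution V ζ v) (x y : ℝ) :
    wronskian u v x = wronskian u v y := by
  have h1 := mul_sub_mul_eq_integral (F := deriv v)
    (intervalIntegrable_potential_mul hV (ζ ^ 2) hv.continuous) hv.2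
    (fun t => (hu.1 t).hasDerivAt) (hu.continuous_deriv hV) x y
  have h2 := mul_sub_mul_eq_integral (F := deriv u)
    (intervalIntegrable_potential_mul hV (ζ ^ 2) hu.continuous) hu.2
    (fun t => (hv.1 t).hasDerivAt) (hv.continuous_deriv hV) x y
  have h3 : ∫ t in x..y, (((V t : ℂ) - ζ ^ 2) * v t * u t + deriv v t * deriv u t)
      = ∫ t in x..y, (((V t : ℂ) - ζ ^ 2) * u t * v t + deriv u t * deriv v t) :=
    intervalIntegral.integral_congr fun t _ => by ring
  simp only [wronskian]
  linear_combination h2 - h1 - h3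

/-- Agreement on an open set transfers derivatives too, and the values of `f` and `deriv f` at the
jump `y` itself play no role. -/
theorem rightLim_eq_of_eqOn {f g : ℝ → ℂ} {y : ℝ} {U : Set ℝ} (hU : IsOpen U)
    (hUy : U ∈ 𝓝[>] y) (h : EqOn f g U) (hg : Continuous g) (hg' : Continuous (deriv g)) :
    Function.rightLim f y = g y ∧ Function.rightLim (deriv f) y = deriv g y := by
  constructor
  · refine rightLim_eq_of_tendsto (Tendsto.congr' ?_ (hg.tendsto y |>.mono_left inf_le_left))
    filter_upwards [hUy] with x hx using (h hx).symm
  · refine rightLim_eq_of_tendsto (Tendsto.congr' ?_ (hg'.tendsto y |>.mono_left inf_le_left))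
    filter_upwards [hUy] with x hx
    exact (h.eventuallyEq_of_mem (hU.mem_nhds hx)).deriv_eq.symm

theorem leftLim_eq_of_eqOn {f g : ℝ → ℂ} {y : ℝ} {U : Set ℝ} (hU : IsOpen U)
    (hUy : U ∈ 𝓝[<] y) (h : EqOn f g U) (hg : Continuous g) (hg' : Continuous (deriv g)) :
    Function.leftLim f y = g y ∧ Function.leftLim (deriv f) y = deriv g y := by
  constructor
  · refine leftLim_eq_of_tendsto (Tendsto.congr' ?_ (hg.tendsto y |>.mono_left inf_le_left))
    filter_upwards [hUy] with x hx using (h hx).symm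
  · refine leftLim_eq_of_tendsto (Tendsto.congr' ?_ (hg'.tendsto y |>.mono_left inf_le_left))
    filter_upwards [hUy] with x hx
    exact (h.eventuallyEq_of_mem (hU.mem_nhds hx)).deriv_eq.symm

/-- `Gamma1` of a function that equals `k p c` to the right of `b` and `k q d` to the left. -/
theorem Gamma1_piecewise_right {a b : ℝ} (hab : a < b) {c d : ℝ → ℂ} (hc : Differentiable ℝ c)
    (hc' : Continuous (deriv c)) (hd : Differentiable ℝ d) (hd' : Continuous (deriv d))
    (k p q : ℂ) :
    Gamma1 a b (fun x => k * (if b ≤ x then c x * p else d x * q)) =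
      ![k * ((c b * p + d b * q) / 2), k * ((deriv c b * p + deriv d b * q) / 2),
        k * (d a * q), k * (deriv d a * q)] := by
  set f : ℝ → ℂ := fun x => k * (if b ≤ x then c x * p else d x * q)
  have hdc : deriv (fun x => k * (c x * p)) = fun x => k * (deriv c x * p) := funext fun x =>
    (((hc x).hasDerivAt.mul_const p).const_mul k).deriv
  have hdd : deriv (fun x => k * (d x * q)) = fun x => k * (deriv d x * q) := funext fun x =>
    (((hd x).hasDerivAt.mul_const q).const_mul k).deriv
  have hcc := hc.continuous
  have hdc0 := hd.continuous
  have e1 : EqOn f (fun x => k * (c x * p)) (Ioi b) := fun x hx => by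
    simp only [f, if_pos (le_of_lt (mem_Ioi.1 hx))]
  have e2 : EqOn f (fun x => k * (d x * q)) (Iio b) := fun x hx => by
    simp only [f, if_neg (not_le.2 (mem_Iio.1 hx))]
  obtain ⟨r1, r2⟩ := rightLim_eq_of_eqOn isOpen_Ioi self_mem_nhdsWithin e1 (by fun_prop)
    (by rw [hdc]; fun_prop)
  obtain ⟨r3, r4⟩ := leftLim_eq_of_eqOn isOpen_Iio self_mem_nhdsWithin e2 (by fun_prop)
    (by rw [hdd]; fun_prop)
  obtain ⟨r5, r6⟩ := rightLim_eq_of_eqOn (y := a) isOpen_Iio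
    (mem_nhdsWithin_of_mem_nhds (Iio_mem_nhds hab)) e2 (by fun_prop) (by rw [hdd]; fun_prop)
  obtain ⟨r7, r8⟩ := leftLim_eq_of_eqOn (y := a) isOpen_Iio
    (mem_nhdsWithin_of_mem_nhds (Iio_mem_nhds hab)) e2 (by fun_prop) (by rw [hdd]; fun_prop)
  rw [Gamma1, r1, r2, r3, r4, r5, r6, r7, r8, hdc, hdd]
  congr 1 <;> [skip; congr 1 <;> [skip; congr 1 <;> [skip; congr 1]]] <;> ring

/-- `Gamma1` of a function that equals `k p c` to the right of `a` and `k q d` to the left. -/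
theorem Gamma1_piecewise_left {a b : ℝ} (hab : a < b) {c d : ℝ → ℂ} (hc : Differentiable ℝ c)
    (hc' : Continuous (deriv c)) (hd : Differentiable ℝ d) (hd' : Continuous (deriv d))
    (k p q : ℂ) :
    Gamma1 a b (fun x => k * (if a ≤ x then c x * p else d x * q)) =
      ![k * (c b * p), k * (deriv c b * p),
        k * ((c a * p + d a * q) / 2), k * ((deriv c a * p + deriv d a * q) / 2)] := by
  set f : ℝ → ℂ := fun x => k * (if a ≤ x then c x * p else d x * q)
  have hdc : deriv (fun x => k * (c x * p)) = fun x => k * (deriv c x * p) := funext fun x =>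
    (((hc x).hasDerivAt.mul_const p).const_mul k).deriv
  have hdd : deriv (fun x => k * (d x * q)) = fun x => k * (deriv d x * q) := funext fun x =>
    (((hd x).hasDerivAt.mul_const q).const_mul k).deriv
  have hcc := hc.continuous
  have hdc0 := hd.continuous
  have e1 : EqOn f (fun x => k * (c x * p)) (Ioi a) := fun x hx => by
    simp only [f, if_pos (le_of_lt (mem_Ioi.1 hx))]
  have e2 : EqOn f (fun x => k * (d x * q)) (Iio a) := fun x hx => by
    simp only [f, if_neg (not_le.2 (mem_Iio.1 hx))]
  obtain ⟨r1, r2⟩ := rightLim_eq_of_eqOn (y := b) isOpen_Ioi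
    (mem_nhdsWithin_of_mem_nhds (Ioi_mem_nhds hab)) e1 (by fun_prop) (by rw [hdc]; fun_prop)
  obtain ⟨r3, r4⟩ := leftLim_eq_of_eqOn (y := b) isOpen_Ioi
    (mem_nhdsWithin_of_mem_nhds (Ioi_mem_nhds hab)) e1 (by fun_prop) (by rw [hdc]; fun_prop)
  obtain ⟨r5, r6⟩ := rightLim_eq_of_eqOn isOpen_Ioi self_mem_nhdsWithin e1 (by fun_prop)
    (by rw [hdc]; fun_prop)
  obtain ⟨r7, r8⟩ := leftLim_eq_of_eqOn isOpen_Iio self_mem_nhdsWithin e2 (by fun_prop)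
    (by rw [hdd]; fun_prop)
  rw [Gamma1, r1, r2, r3, r4, r5, r6, r7, r8, hdc, hdd]
  congr 1 <;> [skip; congr 1 <;> [skip; congr 1 <;> [skip; congr 1]]] <;> ring

/-- The Weyl matrix multiplied by the Jost function, in terms of the boundary values
`A = χ₋(b)χ₊(b)`, `B = χ₋'(b)χ₊(b)`, `G = χ₊(b)χ₋(a)`, `H = χ₊(a)χ₋(a)`, `J = χ₊'(a)χ₋(a)`. -/
def weylNumerator (ζ A B G H J : ℂ) : Matrix (Fin 4) (Fin 4) ℂ :=
  !![A, (B + I * ζ * A) / 2, G, -(I * ζ * G);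
     (B + I * ζ * A) / 2, I * ζ * B, I * ζ * G, ζ ^ 2 * G;
     G, I * ζ * G, H, (J - I * ζ * H) / 2;
     -(I * ζ * G), ζ ^ 2 * G, (J - I * ζ * H) / 2, -(I * ζ * J)]

/-- The Wronskian is moved from `a` to `b`, where `χ₊` is explicit. Every growing boundary value is
paired with a decaying exponential, so that the factors stay polynomially bounded in `ζ`. -/
theorem weylMatrix_eq {V : ℝ → ℝ} (hV : Integrable V) {a b : ℝ} (hab : a < b)
    (hVa : V =ᵐ[volume.restrict (Iio a)] 0) (hVb : V =ᵐ[volume.restrict (Ioi b)] 0) (z : ℂ) {ζ : ℂ}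
    (hζ : upperSqrt z = ζ) :
    weylMatrix V a b z =
      ((deriv (jostMinus V a ζ) b - I * ζ * jostMinus V a ζ b) * exp (I * ζ * b))⁻¹ •
        weylNumerator ζ (jostMinus V a ζ b * exp (I * ζ * b))
          (deriv (jostMinus V a ζ) b * exp (I * ζ * b)) (exp (I * ζ * b) * exp (-(I * ζ * a)))
          (jostPlus V b ζ a * exp (-(I * ζ * a)))
          (deriv (jostPlus V b ζ) a * exp (-(I * ζ * a))) := by
  have hm := isJostMinus_jostMinus hV hVa ζ
  have hp := isJostPlus_jostPlus hV hVb ζ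
  obtain ⟨hma, hma'⟩ := hm.cauchy_data hV
  obtain ⟨hpb, hpb'⟩ := hp.cauchy_data hV
  have hw : jostFun V a b ζ =
      (deriv (jostMinus V a ζ) b - I * ζ * jostMinus V a ζ b) * exp (I * ζ * b) := by
    rw [jostFun, wronskian_const hV hp.1 hm.1 a b, wronskian, hpb, hpb']
    ring
  have hR := Gamma1_piecewise_right hab hp.1.1 (hp.1.continuous_deriv hV) hm.1.1
    (hm.1.continuous_deriv hV) (1 / jostFun V a b ζ)
  have hL := Gamma1_piecewise_left hab hp.1.1 (hp.1.continuous_deriv hV) hm.1.1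
    (hm.1.continuous_deriv hV) (1 / jostFun V a b ζ)
  have g0 : gammaField V a b z 0 = fun x => 1 / jostFun V a b ζ * (if b ≤ x then
      jostPlus V b ζ x * jostMinus V a ζ b else jostMinus V a ζ x * jostPlus V b ζ b) := by
    rw [← hζ]; rfl
  have g1 : gammaField V a b z 1 = fun x => 1 / jostFun V a b ζ * (if b ≤ x then
      jostPlus V b ζ x * deriv (jostMinus V a ζ) b
      else jostMinus V a ζ x * deriv (jostPlus V b ζ) b) := by
    ext x
    change -greenH V a b z x b = _
    simp only [greenH, kernelH, hζ, neg_mul, neg_neg]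
  have g2 : gammaField V a b z 2 = fun x => 1 / jostFun V a b ζ * (if a ≤ x then
      jostPlus V b ζ x * jostMinus V a ζ a else jostMinus V a ζ x * jostPlus V b ζ a) := by
    rw [← hζ]; rfl
  have g3 : gammaField V a b z 3 = fun x => 1 / jostFun V a b ζ * (if a ≤ x then
      jostPlus V b ζ x * deriv (jostMinus V a ζ) a
      else jostMinus V a ζ x * deriv (jostPlus V b ζ) a) := by
    ext x
    change -greenH V a b z x a = _
    simp only [greenH, kernelH, hζ, neg_mul, neg_neg]
  rw [← hw]
  ext i j
  rw [weylMatrix, Matrix.of_apply]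
  fin_cases j
  · simp only [Fin.zero_eta, g0, hR, hma, hma', hpb, hpb']
    fin_cases i <;> simp [weylNumerator, -mul_eq_mul_left_iff, -mul_eq_mul_right_iff] <;> ring
  · simp only [Fin.mk_one, g1, hR, hma, hma', hpb, hpb']
    fin_cases i <;> simp [weylNumerator, -mul_eq_mul_left_iff, -mul_eq_mul_right_iff] <;> ring_nf
    simp only [I_sq]
    ring
  · simp only [Fin.reduceFinMk, g2, hL, hma, hma', hpb, hpb']
    fin_cases i <;> simp [weylNumerator, -mul_eq_mul_left_iff, -mul_eq_mul_right_iff] <;> ring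
  · simp only [Fin.reduceFinMk, g3, hL, hma, hma', hpb, hpb']
    fin_cases i <;> simp [weylNumerator, -mul_eq_mul_left_iff, -mul_eq_mul_right_iff] <;> ring_nf
    simp only [I_sq]
    ring

/-! ### The determinant: rescaling by trace order and first-order expansion -/

/-- Order of growth, in powers of `ζ`, of the boundary values of a plane wave. -/
def traceOrder : Fin 4 → ℕ := ![0, 1, 0, 1]

theorem norm_weylNumerator_le {ζ A B G H J : ℂ} {C : ℝ} (hA : ‖A‖ ≤ C)
    (hB : ‖B‖ ≤ C * (1 + ‖ζ‖)) (hG : ‖G‖ ≤ C) (hH : ‖H‖ ≤ C) (hJ : ‖J‖ ≤ C * (1 + ‖ζ‖))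
    (i j : Fin 4) :
    ‖weylNumerator ζ A B G H J i j‖ ≤
      C * (1 + ‖ζ‖) ^ traceOrder i * (1 + ‖ζ‖) ^ traceOrder j := by
  have hC : 0 ≤ C := (norm_nonneg _).trans hA
  set s := 1 + ‖ζ‖ with hs
  have hζs : ‖ζ‖ ≤ s := by linarith
  have hs0 : 0 ≤ s := by positivity
  have m1 : ∀ {X : ℂ}, ‖X‖ ≤ C → ‖I * ζ * X‖ ≤ C * s := fun {X} hX => by
    rw [norm_mul, norm_mul, norm_I, one_mul, mul_comm]
    exact mul_le_mul hX hζs (norm_nonneg _) hC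
  have m2 : ∀ {X : ℂ}, ‖X‖ ≤ C * s → ‖I * ζ * X‖ ≤ C * s * s := fun {X} hX => by
    rw [norm_mul, norm_mul, norm_I, one_mul, mul_comm]
    exact mul_le_mul hX hζs (norm_nonneg _) (by positivity)
  have m3 : ‖ζ ^ 2 * G‖ ≤ C * s * s := by
    have := m2 (m1 hG)
    rwa [show I * ζ * (I * ζ * G) = -(ζ ^ 2 * G) by linear_combination ζ ^ 2 * G * I_sq,
      norm_neg] at this
  have m4 : ‖(B + I * ζ * A) / 2‖ ≤ C * s := by
    rw [norm_div, Complex.norm_ofNat, div_le_iff₀ two_pos]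
    exact (norm_add_le _ _).trans (by linarith [m1 hA])
  have m5 : ‖(J - I * ζ * H) / 2‖ ≤ C * s := by
    rw [norm_div, Complex.norm_ofNat, div_le_iff₀ two_pos]
    exact (norm_sub_le _ _).trans (by linarith [m1 hH])
  have m6 := m1 hG
  have m7 := m2 hB
  have m8 := m2 hJ
  simp at m3 m4 m5 m6 m7 m8
  fin_cases i <;> fin_cases j <;> simp [weylNumerator, traceOrder] <;> assumption

theorem det_matA (θ₁ θ₂ : ℂ) :
    (matA θ₁ θ₂).det = 4 * (1 + Complex.cosh (θ₁ / 2)) * (1 + Complex.cosh (θ₂ / 2)) := by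
  have hd : matA θ₁ θ₂ = Matrix.diagonal ![1 + exp (θ₂ / 2), 1 + exp (θ₁ / 2),
      1 + exp (-θ₂ / 2), 1 + exp (-θ₁ / 2)] := by
    ext i j
    fin_cases i <;> fin_cases j <;> simp [matA]
  have h1 : exp (θ₁ / 2) * exp (-θ₁ / 2) = 1 := by rw [← exp_add]; ring_nf; exact exp_zero
  have h2 : exp (θ₂ / 2) * exp (-θ₂ / 2) = 1 := by rw [← exp_add]; ring_nf; exact exp_zero
  rw [hd, Matrix.det_diagonal, Fin.prod_univ_four, Complex.cosh, Complex.cosh]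
  simp only [Matrix.cons_val, ← neg_div]
  linear_combination (1 + exp (θ₁ / 2)) * (1 + exp (-θ₁ / 2)) * h2
    + (2 + exp (θ₂ / 2) + exp (-θ₂ / 2)) * h1

theorem norm_exp_half_sub_one_le {θ : ℂ} (hθ : ‖θ‖ ≤ 1) : ‖exp (θ / 2) - 1‖ ≤ ‖θ‖ := by
  have h : ‖θ / 2‖ = ‖θ‖ / 2 := by rw [norm_div, Complex.norm_ofNat]
  have := Complex.norm_exp_sub_one_le (x := θ / 2) (by rw [h]; linarith)
  rw [h] at this
  linarith

theorem norm_one_add_exp_half_le {θ : ℂ} (hθ : ‖θ‖ ≤ 1) : ‖1 + exp (θ / 2)‖ ≤ 3 := by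
  have h1 := norm_exp_half_sub_one_le hθ
  have h2 : 1 + exp (θ / 2) = (exp (θ / 2) - 1) + 2 := by ring
  rw [h2]
  refine (norm_add_le _ _).trans ?_
  rw [Complex.norm_ofNat]
  linarith

theorem norm_matA_le {θ₁ θ₂ : ℂ} (h₁ : ‖θ₁‖ ≤ 1) (h₂ : ‖θ₂‖ ≤ 1) (i j : Fin 4) :
    ‖matA θ₁ θ₂ i j‖ ≤ 3 := by
  have e1 := norm_one_add_exp_half_le h₁
  have e2 := norm_one_add_exp_half_le h₂
  have e3 := norm_one_add_exp_half_le (θ := -θ₁) (by rwa [norm_neg])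
  have e4 := norm_one_add_exp_half_le (θ := -θ₂) (by rwa [norm_neg])
  fin_cases i <;> fin_cases j <;> simp [matA] <;> assumption

/-- Row `i` of `B_θ Q` is a small multiple of the row of `Q` with the complementary trace order. The
orders add up to 1, which cancels the factor `s` gained from the Jost function. -/
theorem norm_matB_mul_le {θ₁ θ₂ : ℂ} (h₁ : ‖θ₁‖ ≤ 1) (h₂ : ‖θ₂‖ ≤ 1)
    {Q : Matrix (Fin 4) (Fin 4) ℂ} {C s : ℝ} (hs : 0 < s)
    (hQ : ∀ i j, ‖Q i j‖ * s ≤ C * s ^ traceOrder i * s ^ traceOrder j) (i j : Fin 4) :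
    s ^ traceOrder i * ‖(matB θ₁ θ₂ * Q) i j‖ ≤
      2 * C * (‖θ₁‖ + ‖θ₂‖) * s ^ traceOrder j := by
  have hb : ∀ {θ : ℂ}, ‖θ‖ ≤ 1 → ‖2 * (exp (θ / 2) - 1)‖ ≤ 2 * ‖θ‖ := fun {θ} hθ => by
    rw [norm_mul, Complex.norm_ofNat]
    linarith [norm_exp_half_sub_one_le hθ]
  have hb' : ∀ {θ : ℂ}, ‖θ‖ ≤ 1 → ‖2 * (1 - exp (θ / 2))‖ ≤ 2 * ‖θ‖ := fun {θ} hθ => by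
    rw [norm_mul, norm_sub_rev, ← norm_mul]
    exact hb hθ
  have n1 := norm_nonneg θ₁
  have n2 := norm_nonneg θ₂
  have key : ∀ (β : ℂ) (k l : Fin 4), ‖β‖ ≤ 2 * (‖θ₁‖ + ‖θ₂‖) →
      traceOrder k + traceOrder l = 1 →
      s ^ traceOrder k * ‖β * Q l j‖ ≤ 2 * C * (‖θ₁‖ + ‖θ₂‖) * s ^ traceOrder j := by
    intro β k l hβ hkl
    have h := mul_le_mul_of_nonneg_left (hQ l j) (pow_nonneg hs.le (traceOrder k))
    have h' : s ^ traceOrder k * ‖Q l j‖ ≤ C * s ^ traceOrder j := by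
      refine le_of_mul_le_mul_right ?_ hs
      calc _ = s ^ traceOrder k * (‖Q l j‖ * s) := by ring
        _ ≤ _ := h
        _ = s ^ (traceOrder k + traceOrder l) * (C * s ^ traceOrder j) := by rw [pow_add]; ring
        _ = _ := by rw [hkl]; ring
    calc _ = ‖β‖ * (s ^ traceOrder k * ‖Q l j‖) := by rw [norm_mul]; ring
      _ ≤ (2 * (‖θ₁‖ + ‖θ₂‖)) * (C * s ^ traceOrder j) :=
        mul_le_mul hβ h' (by positivity) (by positivity)
      _ = _ := by ring
  have r0 : (matB θ₁ θ₂ * Q) 0 j = 2 * (1 - exp (θ₂ / 2)) * Q 1 j := by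
    simp [Matrix.mul_apply, Fin.sum_univ_four, matB]
  have r1 : (matB θ₁ θ₂ * Q) 1 j = 2 * (exp (θ₁ / 2) - 1) * Q 0 j := by
    simp [Matrix.mul_apply, Fin.sum_univ_four, matB]
  have r2 : (matB θ₁ θ₂ * Q) 2 j = 2 * (1 - exp (-θ₂ / 2)) * Q 3 j := by
    simp [Matrix.mul_apply, Fin.sum_univ_four, matB]
  have r3 : (matB θ₁ θ₂ * Q) 3 j = 2 * (exp (-θ₁ / 2) - 1) * Q 2 j := by
    simp [Matrix.mul_apply, Fin.sum_univ_four, matB]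
  have b0 := hb' h₂
  have b1 := hb h₁
  have b2 := hb' (θ := -θ₂) (by rwa [norm_neg])
  have b3 := hb (θ := -θ₁) (by rwa [norm_neg])
  rw [norm_neg] at b2 b3
  fin_cases i
  · exact r0 ▸ key _ 0 1 (by linarith) rfl
  · exact r1 ▸ key _ 1 0 (by linarith) rfl
  · exact r2 ▸ key _ 2 3 (by linarith) rfl
  · exact r3 ▸ key _ 3 2 (by linarith) rfl

/-- The determinant is Lipschitz on bounded sets of matrices. -/
theorem exists_det_lipschitz (R : ℝ) (hR : 0 ≤ R) : ∃ L : ℝ, 0 ≤ L ∧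
    ∀ (M N : Matrix (Fin 4) (Fin 4) ℂ) (ε : ℝ), 0 ≤ ε → (∀ i j, ‖M i j‖ ≤ R) →
      (∀ i j, ‖N i j‖ ≤ R) → (∀ i j, ‖M i j - N i j‖ ≤ ε) → ‖M.det - N.det‖ ≤ L * ε := by
  let f : ContinuousMultilinearMap ℂ (fun _ : Fin 4 => Fin 4 → ℂ) ℂ :=
    { toMultilinearMap := (Matrix.detRowAlternating (n := Fin 4) (R := ℂ)).toMultilinearMap
      cont := by
        change Continuous fun M : Fin 4 → Fin 4 → ℂ => Matrix.det (Matrix.of M)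
        exact Continuous.matrix_det continuous_id }
  refine ⟨‖f‖ * 4 * R ^ 3, by positivity, fun M N ε hε hM hN hMN => ?_⟩
  have h := f.norm_image_sub_le (fun i => M i) (fun i => N i)
  have e1 : ‖(fun i => M i : Fin 4 → Fin 4 → ℂ)‖ ≤ R :=
    (pi_norm_le_iff_of_nonneg hR).2 fun i => (pi_norm_le_iff_of_nonneg hR).2 fun j => hM i j
  have e2 : ‖(fun i => N i : Fin 4 → Fin 4 → ℂ)‖ ≤ R :=
    (pi_norm_le_iff_of_nonneg hR).2 fun i => (pi_norm_le_iff_of_nonneg hR).2 fun j => hN i j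
  have e3 : ‖(fun i => M i : Fin 4 → Fin 4 → ℂ) - fun i => N i‖ ≤ ε :=
    (pi_norm_le_iff_of_nonneg hε).2 fun i => (pi_norm_le_iff_of_nonneg hε).2 fun j => hMN i j
  refine le_trans h ?_
  simp only [Fintype.card_fin, Nat.cast_ofNat, Nat.add_one_sub_one]
  gcongr
  exact max_le e1 e2

theorem exists_det_bound (C : ℝ) (hC : 0 ≤ C) : ∃ L : ℝ, 0 ≤ L ∧
    ∀ (Q : Matrix (Fin 4) (Fin 4) ℂ) (s : ℝ), 0 < s →
      (∀ i j, ‖Q i j‖ * s ≤ C * s ^ traceOrder i * s ^ traceOrder j) →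
      ∀ θ₁ θ₂ : ℂ, ‖θ₁‖ ≤ 1 → ‖θ₂‖ ≤ 1 →
        ‖(matB θ₁ θ₂ * Q - matA θ₁ θ₂).det -
          4 * (1 + Complex.cosh (θ₁ / 2)) * (1 + Complex.cosh (θ₂ / 2))‖ ≤
          L * (‖θ₁‖ + ‖θ₂‖) := by
  obtain ⟨L, hL, H⟩ := exists_det_lipschitz (4 * C + 3) (by positivity)
  refine ⟨L * (2 * C), by positivity, fun Q s hs hQ θ₁ θ₂ h₁ h₂ => ?_⟩
  have hsc : ∀ k : ℕ, (s : ℂ) ^ k ≠ 0 := fun k => pow_ne_zero _ (ofReal_ne_zero.2 hs.ne')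
  -- `N` is `B_θ Q` conjugated by `diag(s ^ traceOrder i)`; the conjugation fixes the diagonal
  -- matrix `A_θ`.
  let N : Matrix (Fin 4) (Fin 4) ℂ := Matrix.of fun i j =>
    (s : ℂ) ^ traceOrder i * ((s : ℂ) ^ traceOrder j)⁻¹ * (matB θ₁ θ₂ * Q) i j
  have hA : ∀ i j, matA θ₁ θ₂ i j
      = (s : ℂ) ^ traceOrder i * ((s : ℂ) ^ traceOrder j)⁻¹ * matA θ₁ θ₂ i j := fun i j => by
    by_cases hij : i = j
    · rw [hij, mul_inv_cancel₀ (hsc _), one_mul]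
    · have : matA θ₁ θ₂ i j = 0 := by
        fin_cases i <;> fin_cases j <;> first | exact absurd rfl hij | simp [matA]
      rw [this, mul_zero]
  have hdet : (N - matA θ₁ θ₂).det = (matB θ₁ θ₂ * Q - matA θ₁ θ₂).det := by
    have e : N - matA θ₁ θ₂ = Matrix.of fun i j => (s : ℂ) ^ traceOrder i *
        (Matrix.of fun i j => ((s : ℂ) ^ traceOrder j)⁻¹ *
          (matB θ₁ θ₂ * Q - matA θ₁ θ₂) i j) i j := by
      ext i j
      rw [Matrix.sub_apply, hA]
      simp only [N, Matrix.of_apply, Matrix.sub_apply]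
      ring
    rw [e, Matrix.det_mul_column, Matrix.det_mul_row, ← mul_assoc, ← Finset.prod_mul_distrib]
    simp only [mul_inv_cancel₀ (hsc _), Finset.prod_const_one, one_mul]
  have hN : ∀ i j, ‖N i j‖ ≤ 2 * C * (‖θ₁‖ + ‖θ₂‖) := fun i j => by
    have h := norm_matB_mul_le h₁ h₂ hs hQ i j
    simp only [N, Matrix.of_apply, norm_mul, norm_inv, norm_pow, Complex.norm_real,
      Real.norm_of_nonneg hs.le]
    rw [← div_eq_mul_inv, div_mul_eq_mul_div, div_le_iff₀ (pow_pos hs _)]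
    exact h
  have hdA : (-matA θ₁ θ₂).det = (matA θ₁ θ₂).det := by
    rw [Matrix.det_neg, Fintype.card_fin]
    norm_num
  rw [← det_matA, ← hdA, ← hdet, mul_assoc]
  refine H _ _ _ (by positivity) (fun i j => ?_) (fun i j => ?_) (fun i j => ?_)
  · rw [Matrix.sub_apply]
    refine (norm_sub_le _ _).trans (add_le_add ((hN i j).trans ?_) (norm_matA_le h₁ h₂ i j))
    nlinarith
  · rw [Matrix.neg_apply, norm_neg]
    linarith [norm_matA_le h₁ h₂ i j]
  · rw [Matrix.sub_apply, Matrix.neg_apply, sub_neg_eq_add, sub_add_cancel]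
    exact hN i j

/-- A quantity of first order in `θ` is a combination of `θ₁`, `θ₂` with bounded coefficients. -/
theorem exists_bounded_split {f θ₁ θ₂ : ℂ} {L : ℝ} (hL : 0 ≤ L)
    (hf : ‖f‖ ≤ L * (‖θ₁‖ + ‖θ₂‖)) :
    ∃ p : ℂ × ℂ, ‖p.1‖ ≤ L ∧ ‖p.2‖ ≤ L ∧ f = θ₁ * p.1 + θ₂ * p.2 := by
  have hmul : ∀ θ : ℂ, θ * (star θ / ‖θ‖) = ‖θ‖ := fun θ => by
    rcases eq_or_ne θ 0 with rfl | h
    · simp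
    · have : (‖θ‖ : ℂ) ≠ 0 := ofReal_ne_zero.2 (norm_ne_zero_iff.2 h)
      rw [← mul_div_assoc, div_eq_iff this, ← sq]
      exact Complex.mul_conj' θ
  have hn : ∀ θ : ℂ, ‖star θ / (‖θ‖ : ℂ)‖ ≤ 1 := fun θ => by
    rw [norm_div, norm_star, Complex.norm_real, norm_norm]
    exact div_self_le_one _
  have hr : 0 ≤ ‖θ₁‖ + ‖θ₂‖ := by positivity
  -- Since `θ · conj θ / |θ| = |θ|`, the weights `conj θₖ / |θₖ|` reassemble `g (|θ₁| + |θ₂|) = f`.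
  -- Where `θ = 0` division by zero gives 0, and `f = 0` too.
  set g : ℂ := f / ((‖θ₁‖ + ‖θ₂‖ : ℝ) : ℂ) with hg
  have hgL : ‖g‖ ≤ L := by
    rw [hg, norm_div, Complex.norm_real, Real.norm_of_nonneg hr]
    exact div_le_of_le_mul₀ hr hL hf
  refine ⟨(g * (star θ₁ / ‖θ₁‖), g * (star θ₂ / ‖θ₂‖)), ?_, ?_, ?_⟩
  · rw [norm_mul]
    exact (mul_le_of_le_one_right (norm_nonneg _) (hn _)).trans hgL
  · rw [norm_mul]
    exact (mul_le_of_le_one_right (norm_nonneg _) (hn _)).trans hgL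
  · rw [mul_left_comm, mul_left_comm θ₂, hmul, hmul, ← mul_add, hg]
    rcases hr.eq_or_lt with h | h
    · rw [← h, mul_zero] at hf
      rw [norm_le_zero_iff.1 hf]
      simp
    · push_cast
      rw [div_mul_cancel₀]
      exact_mod_cast h.ne'

/-! ### Holomorphy and uniform bounds in the variable `ζ` -/

theorem differentiable_det {n : Type*} [Fintype n] [DecidableEq n] :
    Differentiable ℂ (fun M : n → n → ℂ => (Matrix.of M).det) := by
  simp only [Matrix.det_apply, Matrix.of_apply]
  fun_prop

theorem differentiable_adjugate {n : Type*} [Fintype n] [DecidableEq n] (i j : n) :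
    Differentiable ℂ (fun M : n → n → ℂ => (Matrix.of M).adjugate i j) := by
  have h : Differentiable ℂ fun M : n → n → ℂ => Function.update M j (Pi.single i 1) := by
    refine differentiable_pi.2 fun k => ?_
    by_cases hk : k = j
    · subst hk
      simp only [Function.update_self]
      exact differentiable_const _
    · simp only [Function.update_of_ne hk]
      exact differentiable_apply k
  have := differentiable_det.comp h
  simp only [Matrix.adjugate_apply]
  exact this

theorem differentiableAt_matrix_inv {n E : Type*} [Fintype n] [DecidableEq n]
    [NormedAddCommGroup E] [NormedSpace ℂ E] {M : E → Matrix n n ℂ} {x : E}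
    (hM : ∀ i j, DifferentiableAt ℂ (fun y => M y i j) x) (hx : (M x).det ≠ 0) (i j : n) :
    DifferentiableAt ℂ (fun y => (M y)⁻¹ i j) x := by
  have hM' : DifferentiableAt ℂ (fun y => fun i j => M y i j) x :=
    differentiableAt_pi.2 fun i => differentiableAt_pi.2 fun j => hM i j
  have h1 : DifferentiableAt ℂ (fun y => (M y).det) x :=
    (differentiable_det (n := n) _).comp x hM'
  have h2 : DifferentiableAt ℂ (fun y => (M y).adjugate i j) x :=
    (differentiable_adjugate i j _).comp x hM'
  have e : (fun y => (M y)⁻¹ i j) = fun y => ((M y).det)⁻¹ * (M y).adjugate i j := by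
    ext y
    rw [Matrix.inv_def, Ring.inverse_eq_inv', Matrix.smul_apply, smul_eq_mul]
  rw [e]
  exact (h1.inv hx).mul h2

theorem differentiable_matA (i j : Fin 4) :
    Differentiable ℂ (fun θ : ℂ × ℂ => matA θ.1 θ.2 i j) := by
  fin_cases i <;> fin_cases j <;> simp [matA] <;> fun_prop

theorem differentiable_matB (i j : Fin 4) :
    Differentiable ℂ (fun θ : ℂ × ℂ => matB θ.1 θ.2 i j) := by
  fin_cases i <;> fin_cases j <;> simp [matB] <;> fun_prop

/-- The Weyl matrix as a function of `ζ` in the closed upper half-plane. -/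
def weylJost (V : ℝ → ℝ) (a b : ℝ) (ζ : ℂ) : Matrix (Fin 4) (Fin 4) ℂ :=
  ((deriv (jostMinus V a ζ) b - I * ζ * jostMinus V a ζ b) * exp (I * ζ * b))⁻¹ •
    weylNumerator ζ (jostMinus V a ζ b * exp (I * ζ * b))
      (deriv (jostMinus V a ζ) b * exp (I * ζ * b)) (exp (I * ζ * b) * exp (-(I * ζ * a)))
      (jostPlus V b ζ a * exp (-(I * ζ * a)))
      (deriv (jostPlus V b ζ) a * exp (-(I * ζ * a)))

/-- Complex differentiability holds at real `ζ` as well: the ingredients are entire and the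
denominator is nonzero there. -/
theorem differentiableAt_weylJost {V : ℝ → ℝ} (hV : Integrable V) {a b : ℝ} (hab : a < b)
    (hVa : V =ᵐ[volume.restrict (Iio a)] 0) (hVb : V =ᵐ[volume.restrict (Ioi b)] 0)
    (hpos : FormPositive V a b) {ζ : ℂ} (hζ : 0 ≤ ζ.im) (i j : Fin 4) :
    DifferentiableAt ℂ (fun ζ => weylJost V a b ζ i j) ζ := by
  obtain ⟨d1, d2⟩ := differentiable_jostMinus hV hVa b
  obtain ⟨d3, d4⟩ := differentiable_jostPlus hV hVb a
  have hw := mul_ne_zero ((isJostMinus_jostMinus hV hVa ζ).deriv_sub_ne_zero hV hab hpos hζ)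
    (exp_ne_zero (I * ζ * b))
  have h1 : DifferentiableAt ℂ (fun ζ : ℂ =>
      ((deriv (jostMinus V a ζ) b - I * ζ * jostMinus V a ζ b) * exp (I * ζ * b))⁻¹) ζ :=
    DifferentiableAt.inv (by fun_prop) hw
  simp only [weylJost, Matrix.smul_apply, smul_eq_mul]
  refine h1.mul ?_
  fin_cases i <;> fin_cases j <;> simp [weylNumerator] <;> fun_prop

theorem exists_weylJost_bound {V : ℝ → ℝ} (hV : Integrable V) {a b : ℝ} (hab : a < b)
    (hVa : V =ᵐ[volume.restrict (Iio a)] 0) (hVb : V =ᵐ[volume.restrict (Ioi b)] 0)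
    (hpos : FormPositive V a b) :
    ∃ C : ℝ, 0 ≤ C ∧ ∀ ζ : ℂ, 0 ≤ ζ.im → ∀ i j, ‖weylJost V a b ζ i j‖ * (1 + ‖ζ‖) ≤
      C * (1 + ‖ζ‖) ^ traceOrder i * (1 + ‖ζ‖) ^ traceOrder j := by
  obtain ⟨C₁, h₁⟩ := exists_jostMinus_bounds hV hab.le hVa
  obtain ⟨C₂, h₂⟩ := exists_jostMinus_bounds hV.comp_neg (neg_le_neg hab.le)
    (ae_restrict_Iio_reflect hVb)
  obtain ⟨c, hc, hlow⟩ := exists_jost_lower_bound hV hab hVa hpos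
  set C := max (max C₁ C₂) 1
  have hC : 0 ≤ C := zero_le_one.trans (le_max_right _ _)
  refine ⟨C / c, by positivity, fun ζ hζ i j => ?_⟩
  have hs : 0 ≤ 1 + ‖ζ‖ := by positivity
  have hC₁ : C₁ ≤ C := (le_max_left _ _).trans (le_max_left _ _)
  have hC₂ : C₂ ≤ C := (le_max_right _ _).trans (le_max_left _ _)
  obtain ⟨hA, hB⟩ := h₁ ζ hζ
  obtain ⟨hH, hJ⟩ := h₂ ζ hζ
  have hG : ‖exp (I * ζ * b) * exp (-(I * ζ * a))‖ ≤ C := by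
    have e : exp (I * ζ * b) * exp (-(I * ζ * a)) = exp (I * ζ * ((b - a : ℝ) : ℂ)) := by
      rw [← exp_add]
      push_cast
      ring_nf
    rw [e]
    exact (norm_exp_I_mul_le_one hζ (by linarith)).trans (le_max_right _ _)
  have ea : exp (I * ζ * ((-a : ℝ) : ℂ)) = exp (-(I * ζ * a)) := by
    push_cast
    rw [mul_neg]
  rw [ea] at hH hJ
  have hn := norm_weylNumerator_le (hA.trans hC₁)
    (hB.trans (mul_le_mul_of_nonneg_right hC₁ hs)) hG
    (H := jostPlus V b ζ a * exp (-(I * ζ * a)))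
    (J := deriv (jostPlus V b ζ) a * exp (-(I * ζ * a)))
    (by rw [jostPlus_eq_reflect hV hVb]; exact hH.trans hC₂)
    (by
      rw [deriv_jostPlus_eq_reflect hV hVb, neg_mul, norm_neg]
      exact hJ.trans (mul_le_mul_of_nonneg_right hC₂ hs)) i j
  have hl := hlow ζ hζ
  have hs' : 0 < 1 + ‖ζ‖ := by positivity
  have hw : 0 < ‖(deriv (jostMinus V a ζ) b - I * ζ * jostMinus V a ζ b) * exp (I * ζ * b)‖ :=
    lt_of_lt_of_le (by positivity) hl
  rw [weylJost, Matrix.smul_apply, smul_eq_mul, norm_mul, norm_inv, mul_assoc,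
    inv_mul_le_iff₀ hw]
  calc _ ≤ C * (1 + ‖ζ‖) ^ traceOrder i * (1 + ‖ζ‖) ^ traceOrder j * (1 + ‖ζ‖) :=
        mul_le_mul_of_nonneg_right hn hs
    _ = (c * (1 + ‖ζ‖)) *
        (C / c * (1 + ‖ζ‖) ^ traceOrder i * (1 + ‖ζ‖) ^ traceOrder j) := by field_simp
    _ ≤ _ := mul_le_mul_of_nonneg_right hl (by positivity)

/-! ### Branches of the square root at the cut; choice of the radius -/

/-- The root `r` has positive real part unless `x = 0`, and `(Re r)² - (Im r)² = Re x ≥ 0`. -/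
theorem abs_im_cpow_half_le_re {x : ℂ} (hx : 0 ≤ x.re) :
    |(x ^ (1 / 2 : ℂ)).im| ≤ (x ^ (1 / 2 : ℂ)).re := by
  rcases eq_or_ne x 0 with rfl | hx0
  · rw [zero_cpow (by norm_num)]
    simp
  · have hcut : -x ∉ cut := fun h => hx0 (by
      obtain ⟨h1, h2⟩ := h
      rw [neg_im] at h1
      rw [neg_re] at h2
      exact Complex.ext (by simp; linarith) (by simp; linarith))
    have h1 := upperSqrt_im_pos hcut
    have h2 := upperSqrt_sq (-x)
    rw [upperSqrt, neg_neg] at h1 h2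
    have h3 : (x ^ (1 / 2 : ℂ)) ^ 2 = x := by
      linear_combination -h2 + (x ^ (1 / 2 : ℂ)) ^ 2 * I_sq
    generalize x ^ (1 / 2 : ℂ) = r at *
    simp only [mul_im, I_re, I_im, zero_mul, one_mul, zero_add] at h1
    have h4 := congrArg Complex.re h3
    rw [sq, mul_re] at h4
    refine abs_le_of_sq_le_sq ?_ h1.le
    nlinarith

theorem upperSqrt_eq_of_sq_eq {z ζ : ℂ} (hz : z ∉ cut) (hζ : ζ ^ 2 = z) (him : 0 ≤ ζ.im) :
    ζ = upperSqrt z := by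
  rcases eq_or_eq_neg_of_sq_eq_sq ζ (upperSqrt z) (hζ.trans (upperSqrt_sq z).symm) with h | h
  · exact h
  · have := upperSqrt_im_pos hz
    rw [h, neg_im] at him
    linarith

/-- The square root with nonnegative imaginary part, continued to the half-plane
`0 ≤ (σ z).re` from the complement of the cut; here `σ = ∓i` for the upper and lower half-plane. -/
theorem exists_sqrt_extension {σ κ : ℂ} (hσ : κ ^ 2 * σ = 1) (hκ : |κ.re| ≤ κ.im) :
    ∃ S : ℂ → ℂ, ContinuousOn S {z | 0 ≤ (σ * z).re} ∧
      (∀ z, 0 ≤ (σ * z).re → 0 ≤ (S z).im) ∧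
      ∀ z, 0 ≤ (σ * z).re → z ∉ cut → S z = upperSqrt z := by
  have him : ∀ z, 0 ≤ (σ * z).re → 0 ≤ (κ * (σ * z) ^ (1 / 2 : ℂ)).im := fun z hz => by
    have h := abs_im_cpow_half_le_re hz
    generalize (σ * z) ^ (1 / 2 : ℂ) = r at *
    rw [mul_im]
    have h1 := mul_le_mul hκ h (abs_nonneg _) ((abs_nonneg _).trans hκ)
    rw [← abs_mul] at h1
    linarith [neg_abs_le (κ.re * r.im)]
  refine ⟨fun z => κ * (σ * z) ^ (1 / 2 : ℂ), fun z hz => ContinuousAt.continuousWithinAt ?_, him,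
    fun z hz hcut => upperSqrt_eq_of_sq_eq hcut ?_ (him z hz)⟩
  -- The rotation by `σ` moves the half-plane to `Re ≥ 0`, away from the branch cut of the principal
  -- root, which is continuous at 0 too.
  · refine continuousAt_const.mul ?_
    have h1 : ContinuousAt (fun x : ℂ => x ^ (1 / 2 : ℂ)) (σ * z) :=
      continuousAt_cpow_const_of_re_pos (Or.inl hz) (by norm_num)
    exact ContinuousAt.comp (f := fun z => σ * z) h1 (by fun_prop)
  · have h : ((σ * z) ^ (1 / 2 : ℂ)) ^ 2 = σ * z := by
      rw [one_div]
      exact_mod_cast Complex.cpow_nat_inv_pow (σ * z) (n := 2) two_ne_zero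
    rw [mul_pow, h]
    linear_combination z * hσ

theorem differentiableAt_upperSqrt {z : ℂ} (hz : z ∉ cut) : DifferentiableAt ℂ upperSqrt z := by
  have hm : -z ∈ slitPlane := by
    rw [mem_slitPlane_iff]
    by_contra! h
    rw [neg_re, neg_im] at h
    exact hz ⟨by linarith [h.2], by linarith [h.1]⟩
  exact (differentiableAt_id.neg.cpow_const hm).const_mul I

theorem norm_lt_of_mem_thetaBall {δ : ℝ} (hδ : 0 ≤ δ) {θ : ℂ × ℂ} (hθ : θ ∈ thetaBall δ) :
    ‖θ.1‖ < δ ∧ ‖θ.2‖ < δ := by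
  have h : ‖θ.1‖ ^ 2 + ‖θ.2‖ ^ 2 < δ ^ 2 := hθ
  exact ⟨lt_of_pow_lt_pow_left₀ 2 hδ (by linarith [sq_nonneg ‖θ.2‖]),
    lt_of_pow_lt_pow_left₀ 2 hδ (by linarith [sq_nonneg ‖θ.1‖])⟩

/-- A perturbation of `4 (1 + cosh (θ₁/2)) (1 + cosh (θ₂/2))` of first order in `θ` has no zeros
near the origin. -/
theorem exists_radius_ne_zero (L : ℝ) : ∃ δ : ℝ, 0 < δ ∧ δ ≤ 1 ∧
    ∀ θ ∈ thetaBall δ, ∀ D : ℂ,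
      ‖D - 4 * (1 + Complex.cosh (θ.1 / 2)) * (1 + Complex.cosh (θ.2 / 2))‖ ≤
        L * (‖θ.1‖ + ‖θ.2‖) → D ≠ 0 := by
  have hcont : Continuous fun θ : ℂ × ℂ =>
      ‖4 * (1 + Complex.cosh (θ.1 / 2)) * (1 + Complex.cosh (θ.2 / 2))‖
        - L * (‖θ.1‖ + ‖θ.2‖) := by
    have := Complex.continuous_cosh
    fun_prop
  have h0 : 0 < ‖4 * (1 + Complex.cosh ((0 : ℂ × ℂ).1 / 2)) *
      (1 + Complex.cosh ((0 : ℂ × ℂ).2 / 2))‖ - L * (‖(0 : ℂ × ℂ).1‖ + ‖(0 : ℂ × ℂ).2‖) := by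
    simp
  obtain ⟨ε, hε, hball⟩ := Metric.eventually_nhds_iff.1
    (hcont.continuousAt.eventually (lt_mem_nhds h0))
  -- At `θ = 0` the main term is 16 and the error bound 0, so the main term dominates for `|θ₁|,
  -- |θ₂| < ε`.
  refine ⟨min ε 1, by positivity, min_le_right _ _, fun θ hθ D hD hD0 => ?_⟩
  obtain ⟨h1, h2⟩ := norm_lt_of_mem_thetaBall (by positivity) hθ
  have := hball (y := θ) (by
    rw [dist_zero_right, Prod.norm_def]
    exact max_lt (h1.trans_le (min_le_left _ _)) (h2.trans_le (min_le_left _ _)))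
  rw [hD0, zero_sub, norm_neg] at hD
  linarith

end KreinModel

end

open KreinModel MeasureTheory Complex Set

/-! ### Assembly of the theorem -/

theorem lemma3 (a b : ℝ) (hab : a < b) (V : ℝ → ℝ)
    (hV : MeasureTheory.Integrable V) (hsupp : essSupport V = Set.Icc a b)
    (hpos : FormPositive V a b) :
    -- invertibility, holomorphy and continuous extension to both sides of the cut
    (∃ δ : ℝ, 0 < δ ∧
      (∀ z : ℂ, z ∉ cut → ∀ θ ∈ thetaBall δ, IsUnit (kreinMatrix V a b z θ.1 θ.2)) ∧
      (∀ i j : Fin 4, DifferentiableOn ℂ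
        (fun p : ℂ × ℂ × ℂ => (kreinMatrix V a b p.1 p.2.1 p.2.2)⁻¹ i j)
        {p | p.1 ∉ cut ∧ p.2 ∈ thetaBall δ}) ∧
      (∀ i j : Fin 4, ∃ F : ℂ × ℂ × ℂ → ℂ,
        ContinuousOn F {p | 0 ≤ p.1.im ∧ p.2 ∈ thetaBall δ} ∧
        ∀ p : ℂ × ℂ × ℂ, 0 ≤ p.1.im → p.1 ∉ cut → p.2 ∈ thetaBall δ →
          F p = (kreinMatrix V a b p.1 p.2.1 p.2.2)⁻¹ i j) ∧
      (∀ i j : Fin 4, ∃ F : ℂ × ℂ × ℂ → ℂ,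
        ContinuousOn F {p | p.1.im ≤ 0 ∧ p.2 ∈ thetaBall δ} ∧
        ∀ p : ℂ × ℂ × ℂ, p.1.im ≤ 0 → p.1 ∉ cut → p.2 ∈ thetaBall δ →
          F p = (kreinMatrix V a b p.1 p.2.1 p.2.2)⁻¹ i j)) ∧
    -- the determinant expansion, with remainder `O(θ₁) + O(θ₂)` uniform in `z` off the cut
    (∃ (p₁ p₂ : ℂ → ℂ × ℂ → ℂ) (C : ℝ),
      ∀ z : ℂ, z ∉ cut → ∀ θ ∈ thetaBall 1,
        ‖p₁ z θ‖ ≤ C ∧ ‖p₂ z θ‖ ≤ C ∧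
        (kreinMatrix V a b z θ.1 θ.2).det =
          4 * (1 + Complex.cosh (θ.1 / 2)) * (1 + Complex.cosh (θ.2 / 2)) +
            θ.1 * p₁ z θ + θ.2 * p₂ z θ) := by
  have hVa : V =ᵐ[volume.restrict (Iio a)] 0 :=
    ae_eq_zero_of_disjoint_essSupport measurableSet_Iio (by
      rw [hsupp]
      exact disjoint_left.2 fun x hx hx' => absurd hx'.1 (not_le.2 hx))
  have hVb : V =ᵐ[volume.restrict (Ioi b)] 0 :=
    ae_eq_zero_of_disjoint_essSupport measurableSet_Ioi (by
      rw [hsupp]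
      exact disjoint_left.2 fun x hx hx' => absurd hx'.2 (not_le.2 hx))
  obtain ⟨C, hC, hQ⟩ := exists_weylJost_bound hV hab hVa hVb hpos
  obtain ⟨L, hL, hdet⟩ := exists_det_bound C hC
  have hdet' : ∀ ζ : ℂ, 0 ≤ ζ.im → ∀ θ ∈ thetaBall 1,
      ‖(matB θ.1 θ.2 * weylJost V a b ζ - matA θ.1 θ.2).det -
        4 * (1 + Complex.cosh (θ.1 / 2)) * (1 + Complex.cosh (θ.2 / 2))‖ ≤
        L * (‖θ.1‖ + ‖θ.2‖) := fun ζ hζ θ hθ => by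
    obtain ⟨h1, h2⟩ := norm_lt_of_mem_thetaBall zero_le_one hθ
    exact hdet _ _ (by positivity) (hQ ζ hζ) θ.1 θ.2 h1.le h2.le
  have hkrein : ∀ z θ₁ θ₂, kreinMatrix V a b z θ₁ θ₂
      = matB θ₁ θ₂ * weylJost V a b (upperSqrt z) - matA θ₁ θ₂ := fun z θ₁ θ₂ => by
    rw [kreinMatrix, weylMatrix_eq hV hab hVa hVb z rfl, weylJost]
  obtain ⟨δ, hδ, hδ1, hne⟩ := exists_radius_ne_zero L
  have hsub : thetaBall δ ⊆ thetaBall 1 := fun θ hθ =>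
    lt_of_lt_of_le (show ‖θ.1‖ ^ 2 + ‖θ.2‖ ^ 2 < δ ^ 2 from hθ) (by gcongr)
  have hdet0 : ∀ ζ : ℂ, 0 ≤ ζ.im → ∀ θ ∈ thetaBall δ,
      (matB θ.1 θ.2 * weylJost V a b ζ - matA θ.1 θ.2).det ≠ 0 := fun ζ hζ θ hθ =>
    hne θ hθ _ (hdet' ζ hζ θ (hsub hθ))
  -- Here the first coordinate is `ζ`, with the real axis included. Both holomorphy off the cut and
  -- the boundary values follow by inserting a branch of the root.
  have hdiff : ∀ (p : ℂ × ℂ × ℂ), 0 ≤ p.1.im → p.2 ∈ thetaBall δ → ∀ i j,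
      DifferentiableAt ℂ (fun p : ℂ × ℂ × ℂ =>
        (matB p.2.1 p.2.2 * weylJost V a b p.1 - matA p.2.1 p.2.2)⁻¹ i j) p := by
    intro p hp hθ i j
    refine differentiableAt_matrix_inv (x := p) (M := fun p : ℂ × ℂ × ℂ =>
      matB p.2.1 p.2.2 * weylJost V a b p.1 - matA p.2.1 p.2.2)
      (fun k l => ?_) (hdet0 p.1 hp p.2 hθ) i j
    have hB : ∀ m, DifferentiableAt ℂ (fun p : ℂ × ℂ × ℂ => matB p.2.1 p.2.2 k m) p := fun m =>
      DifferentiableAt.comp (f := Prod.snd) p (differentiable_matB k m p.2) differentiableAt_snd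
    have hW : ∀ m, DifferentiableAt ℂ (fun p : ℂ × ℂ × ℂ => weylJost V a b p.1 m l) p := fun m =>
      DifferentiableAt.comp (f := Prod.fst) p
        (differentiableAt_weylJost hV hab hVa hVb hpos hp m l) differentiableAt_fst
    have hA : DifferentiableAt ℂ (fun p : ℂ × ℂ × ℂ => matA p.2.1 p.2.2 k l) p :=
      DifferentiableAt.comp (f := Prod.snd) p (differentiable_matA k l p.2) differentiableAt_snd
    simp only [Matrix.sub_apply, Matrix.mul_apply]
    exact (DifferentiableAt.fun_sum fun m _ => (hB m).mul (hW m)).sub hA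
  have hext : ∀ (i j : Fin 4) {σ κ : ℂ}, κ ^ 2 * σ = 1 → |κ.re| ≤ κ.im →
      ∃ F : ℂ × ℂ × ℂ → ℂ,
        ContinuousOn F {p | 0 ≤ (σ * p.1).re ∧ p.2 ∈ thetaBall δ} ∧
        ∀ p : ℂ × ℂ × ℂ, 0 ≤ (σ * p.1).re → p.1 ∉ cut → p.2 ∈ thetaBall δ →
          F p = (kreinMatrix V a b p.1 p.2.1 p.2.2)⁻¹ i j := by
    intro i j σ κ hσ hκ
    obtain ⟨S, hSc, hSim, hSeq⟩ := exists_sqrt_extension hσ hκ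
    refine ⟨fun p => (matB p.2.1 p.2.2 * weylJost V a b (S p.1) - matA p.2.1 p.2.2)⁻¹ i j, ?_,
      fun p hp hcut _ => by simp only [hkrein, hSeq p.1 hp hcut]⟩
    intro p hp
    have h1 : ContinuousWithinAt (fun p : ℂ × ℂ × ℂ => (S p.1, p.2))
        {p | 0 ≤ (σ * p.1).re ∧ p.2 ∈ thetaBall δ} p :=
      ((hSc p.1 hp.1).comp continuousWithinAt_fst fun q hq => hq.1).prodMk continuousWithinAt_snd
    exact ContinuousAt.comp_continuousWithinAt (f := fun p : ℂ × ℂ × ℂ => (S p.1, p.2))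
      (hdiff (S p.1, p.2) (hSim p.1 hp.1) hp.2 i j).continuousAt h1
  have hsqrt2 : ((Real.sqrt 2 : ℝ) : ℂ) ^ 2 = 2 := by
    rw [← ofReal_pow, Real.sq_sqrt zero_le_two]
    norm_num
  have hsqrt2' : ((Real.sqrt 2 : ℝ) : ℂ) ≠ 0 := fun h => by simp [h] at hsqrt2
  refine ⟨⟨δ, hδ, ?_, ?_, ?_, ?_⟩, ?_⟩
  · intro z hz θ hθ
    rw [hkrein, Matrix.isUnit_iff_isUnit_det, isUnit_iff_ne_zero]
    exact hdet0 _ (upperSqrt_im_pos hz).le θ hθ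
  · intro i j p hp
    refine DifferentiableAt.differentiableWithinAt ?_
    simp only [hkrein]
    exact DifferentiableAt.comp (f := fun p : ℂ × ℂ × ℂ => (upperSqrt p.1, p.2)) p
      (hdiff (upperSqrt p.1, p.2) (upperSqrt_im_pos hp.1).le hp.2 i j)
      (((differentiableAt_upperSqrt hp.1).comp p differentiableAt_fst).prodMk
        differentiableAt_snd)
  · intro i j
    -- `κ = e^{iπ/4}`, and `Re (-i z) = Im z`.
    have := hext i j (σ := -I) (κ := (1 + I) / (Real.sqrt 2 : ℝ)) (by
        field_simp
        rw [hsqrt2]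
        linear_combination (-I - 2) * I_sq) (by
        rw [div_ofReal_re, div_ofReal_im]
        simp [abs_of_nonneg (Real.sqrt_nonneg 2)])
    simpa using this
  · intro i j
    -- `κ = e^{3iπ/4}`, and `Re (i z) = -Im z`.
    have := hext i j (σ := I) (κ := (-1 + I) / (Real.sqrt 2 : ℝ)) (by
        field_simp
        rw [hsqrt2]
        linear_combination (I - 2) * I_sq) (by
        rw [div_ofReal_re, div_ofReal_im]
        simp [abs_div, abs_of_nonneg (Real.sqrt_nonneg 2)])
    simpa using this
  · have hsplit : ∀ (z : ℂ) (θ : ℂ × ℂ), ∃ p : ℂ × ℂ, z ∉ cut → θ ∈ thetaBall 1 →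
        ‖p.1‖ ≤ L ∧ ‖p.2‖ ≤ L ∧ (kreinMatrix V a b z θ.1 θ.2).det =
          4 * (1 + Complex.cosh (θ.1 / 2)) * (1 + Complex.cosh (θ.2 / 2)) +
            θ.1 * p.1 + θ.2 * p.2 := fun z θ => by
      by_cases h : z ∉ cut ∧ θ ∈ thetaBall 1
      · obtain ⟨p, hp₁, hp₂, hpe⟩ :=
          exists_bounded_split hL (hdet' _ (upperSqrt_im_pos h.1).le θ h.2)
        refine ⟨p, fun _ _ => ⟨hp₁, hp₂, ?_⟩⟩
        rw [hkrein]
        linear_combination hpe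
      · exact ⟨0, fun h1 h2 => absurd ⟨h1, h2⟩ h⟩
    choose p hp using hsplit
    exact ⟨fun z θ => (p z θ).1, fun z θ => (p z θ).2, L, fun z hz θ hθ => hp z θ hz hθ⟩
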